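/- Setting. $K$ (categories) and $M$ (user types) are finite nonempty sets, $\bm P\in[0,1]^{K\times M}$, $\bm q$ is a probability distribution on $M$, and $p_{\max}=\max_{k,m}\bm P(k,m)$ is assumed to be $<1$. A policy is a sequence $\pi=(\pi_t)_{t\ge 1}$ in $K$. A user of type $m$ likes the recommendation $\pi_t$ with probability $\bm P(\pi_t,m)$, independently over the rounds, and the session ends with the first dislike; $F(m,\pi)$ is the number of likes in the session. For a horizon $H\ge 1$ put $$V^\pi_H=\sum_{m\in M}\bm q(m)\,\mathbb E\big[\min\{H,F(m,\pi)\}\big].$$ Proposition. There is an algorithm (a single program for a real random-access machine, with exact real arithmetic $+,-,\times,/$ and comparisons, integer addition and subtraction for addresses, and unit cost per operation) that for every such $K,M,\bm P,\bm q$, every $H\ge 1$ and every $\varepsilon>0$ halts and outputs the first $H$ recommendations of a policy; every policy $\pi$ that begins with them satisfies $$V^\pi_H\ \ge\ \max_{\pi'}V^{\pi'}_H-\varepsilon .$$ Whenever $\varepsilon(1-p_{\max})^2\le 1$, it halts within $$O\left(H\cdot|K|\cdot|M|\cdot\left(\frac{1}{\varepsilon(1-p_{\max})^2}\right)^{2|M|-2}\right)$$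 steps, where the constant in the $O$ is absolute. -/

import Mathlib

open MeasureTheory ProbabilityTheory

noncomputable section

/-! ## The recommendation model -/

/-- An instance: a finite set `K` of categories, a finite set `M` of user types, the matrix
`pref k m ∈ [0,1]` of probabilities that category `k` satisfies a user of type `m`, and the prior
distribution over the user types. -/
structure RecAPC (K M : Type) [Fintype M] where
  pref : K → M → unitInterval
  prior : stdSimplex ℝ M

/-- A policy is an infinite sequence of categories; `π t` is recommended in round `t + 1`
(if the session has not ended before). -/
abbrev RecAPC.Policy (K : Type) : Type := ℕ → K

namespace RecAPC

variable {K M : Type} [Fintype M]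

/-- The largest entry of the preference matrix. -/
def pMax (I : RecAPC K M) : ℝ := ⨆ x : K × M, (I.pref x.1 x.2 : ℝ)

/-- The law of the feedback (`true` is "like") of a user of type `m` to the recommendations of
`π`: independent over the rounds, a like in round `t` with probability `pref (π t) m`. What the
user would answer after the end of the session is never used. -/
def feedbackLaw (I : RecAPC K M) (π : Policy K) (m : M) : Measure (ℕ → Bool) :=
  Measure.infinitePi fun t => bernoulliMeasure true false (I.pref (π t) m)

/-- The number of likes in a session that ends with the first dislike: the rounds up to which
(inclusive) all feedback is positive. -/
def likes (ω : ℕ → Bool) : ℕ∞ := {t : ℕ | ∀ s ≤ t, ω s = true}.encard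

/-- The value of a policy for horizon `H`: the expectation of `min {H, F}`, where `F` is the number
of likes of a user whose type is drawn from the prior. -/
def value (I : RecAPC K M) (H : ℕ) (π : Policy K) : ℝ :=
  ∑ m, I.prior m * ∫ ω, ((min (H : ℕ∞) (likes ω)).toNat : ℝ) ∂(I.feedbackLaw π m)

end RecAPC

/-! ## The machine model: a real random-access machine with unit costs

The memory consists of arrays of natural numbers and arrays of real numbers. Addresses are natural
numbers that the program computes with addition and (truncated) subtraction. Real numbers are
stored exactly; the operations on them are `+`, `-`, `*`, `/` and comparison (there is no rounding
to integers). Every elementary operation, memory access and test costs one step. -/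

namespace RealRAM

/-- The memory: `nat a i` and `real a i` are the `i`-th cells of the `a`-th arrays. A program
mentions only finitely many arrays. -/
structure Store where
  nat : ℕ → ℕ → ℕ
  real : ℕ → ℕ → ℝ

def Store.setNat (s : Store) (a i v : ℕ) : Store :=
  { s with nat := Function.update s.nat a (Function.update (s.nat a) i v) }

def Store.setReal (s : Store) (a i : ℕ) (v : ℝ) : Store :=
  { s with real := Function.update s.real a (Function.update (s.real a) i v) }

/-- Integer expressions; `get a i` reads the cell with address `i` of integer array `a`. -/
inductive NatExpr : Type
  | const (n : ℕ)
  | get (a : ℕ) (i : NatExpr)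
  | add (x y : NatExpr)
  | sub (x y : NatExpr)

def NatExpr.eval (s : Store) : NatExpr → ℕ
  | .const n => n
  | .get a i => s.nat a (i.eval s)
  | .add x y => x.eval s + y.eval s
  | .sub x y => x.eval s - y.eval s

def NatExpr.cost : NatExpr → ℕ
  | .const _ => 1
  | .get _ i => i.cost + 1
  | .add x y => x.cost + y.cost + 1
  | .sub x y => x.cost + y.cost + 1

/-- Real expressions; `get a i` reads the cell with address `i` of real array `a`, and `cast`
converts an integer to a real number. The only constants are those that `cast` provides. -/
inductive RealExpr : Type
  | cast (n : NatExpr)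
  | get (a : ℕ) (i : NatExpr)
  | add (x y : RealExpr)
  | sub (x y : RealExpr)
  | mul (x y : RealExpr)
  | div (x y : RealExpr)

def RealExpr.eval (s : Store) : RealExpr → ℝ
  | .cast n => (n.eval s : ℝ)
  | .get a i => s.real a (i.eval s)
  | .add x y => x.eval s + y.eval s
  | .sub x y => x.eval s - y.eval s
  | .mul x y => x.eval s * y.eval s
  | .div x y => x.eval s / y.eval s

def RealExpr.cost : RealExpr → ℕ
  | .cast n => n.cost + 1
  | .get _ i => i.cost + 1
  | .add x y => x.cost + y.cost + 1
  | .sub x y => x.cost + y.cost + 1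
  | .mul x y => x.cost + y.cost + 1
  | .div x y => x.cost + y.cost + 1

/-- Tests. -/
inductive Test : Type
  | natLt (x y : NatExpr)
  | realLt (x y : RealExpr)
  | neg (b : Test)
  | conj (b c : Test)

def Test.Holds (s : Store) : Test → Prop
  | .natLt x y => x.eval s < y.eval s
  | .realLt x y => x.eval s < y.eval s
  | .neg b => ¬ b.Holds s
  | .conj b c => b.Holds s ∧ c.Holds s

def Test.cost : Test → ℕ
  | .natLt x y => x.cost + y.cost + 1
  | .realLt x y => x.cost + y.cost + 1
  | .neg b => b.cost + 1
  | .conj b c => b.cost + c.cost + 1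

/-- Programs. -/
inductive Program : Type
  | skip
  | assignNat (a : ℕ) (i e : NatExpr)
  | assignReal (a : ℕ) (i : NatExpr) (e : RealExpr)
  | seq (p q : Program)
  | cond (b : Test) (p q : Program)
  | loop (b : Test) (p : Program)

/-- `Runs p s t s'`: started in memory `s`, the program `p` halts after exactly `t` steps, in
memory `s'`. Here `loop b p` repeats `p` while `b` holds. -/
inductive Runs : Program → Store → ℕ → Store → Prop
  | skip (s : Store) : Runs .skip s 1 s
  | assignNat (a : ℕ) (i e : NatExpr) (s : Store) :
      Runs (.assignNat a i e) s (i.cost + e.cost + 1) (s.setNat a (i.eval s) (e.eval s))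
  | assignReal (a : ℕ) (i : NatExpr) (e : RealExpr) (s : Store) :
      Runs (.assignReal a i e) s (i.cost + e.cost + 1) (s.setReal a (i.eval s) (e.eval s))
  | seq {p q : Program} {s s' s'' : Store} {t t' : ℕ} :
      Runs p s t s' → Runs q s' t' s'' → Runs (.seq p q) s (t + t') s''
  | cond_true {b : Test} {p : Program} (q : Program) {s s' : Store} {t : ℕ} :
      b.Holds s → Runs p s t s' → Runs (.cond b p q) s (b.cost + t) s'
  | cond_false {b : Test} (p : Program) {q : Program} {s s' : Store} {t : ℕ} :
      ¬ b.Holds s → Runs q s t s' → Runs (.cond b p q) s (b.cost + t) s'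
  | loop_done {b : Test} (p : Program) {s : Store} :
      ¬ b.Holds s → Runs (.loop b p) s b.cost s
  | loop_step {b : Test} {p : Program} {s s' s'' : Store} {t t' : ℕ} :
      b.Holds s → Runs p s t s' → Runs (.loop b p) s' t' s'' →
        Runs (.loop b p) s (b.cost + t + t') s''

/-- The initial memory. Integer array `0` holds `H`, `|K|`, `|M|`; real array `0` holds the
preference matrix row by row, real array `1` the prior, and real array `2` the number `ε`. All other
cells are `0`. -/
def input {nK nM : ℕ} (I : RecAPC (Fin nK) (Fin nM)) (H : ℕ) (ε : ℝ) : Store where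
  nat := fun a i =>
    if a = 0 then (if i = 0 then H else if i = 1 then nK else if i = 2 then nM else 0) else 0
  real := fun a i =>
    if a = 0 then
      (if h : i < nK * nM then
        (I.pref (Fin.divNat (⟨i, h⟩ : Fin (nK * nM))) (Fin.modNat (⟨i, h⟩ : Fin (nK * nM))) : ℝ)
      else 0)
    else if a = 1 then (if h : i < nM then I.prior ⟨i, h⟩ else 0)
    else if a = 2 then (if i = 0 then ε else 0)
    else 0

/-- The memory `s` contains an answer, in the first `H` cells of integer array `1`: the first `H`
recommendations of a policy. -/
def Store.IsAnswer (s : Store) (nK H : ℕ) : Prop := ∀ t < H, s.nat 1 t < nK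

/-- The policy `π` begins with the `H` recommendations that are written in `s`. -/
def Store.Encodes {nK : ℕ} (s : Store) (H : ℕ) (π : RecAPC.Policy (Fin nK)) : Prop :=
  ∀ t < H, (π t : ℕ) = s.nat 1 t

end RealRAM

end

/-! Given the type, the rounds are independent, and min{H, F} counts the j < H for which rounds 0,
..., j are all liked. Hence the value is Σ_m q(m) Σ_{j<H} Π_{t≤j} P(π_t, m): it depends on the first
H recommendations only, and it is linear in the belief q with nonnegative coefficients (`value_eq`,
`linValue`). A like of k has probability r = Σ_m w(m) P(k, m) under belief w and changes w to w(m)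
P(k, m) / r. Planning is thus a dynamic programme on beliefs, U_{h+1}(w) = max_k r (1 + U_h(w')),
except that the reachable beliefs may multiply with every round.

The beliefs are therefore rounded down to a grid of mesh 1/n. Write d = |M| - 1, p for the largest
entry and x = 1 / (ε (1 - p)²). The first d coordinates are rounded down, and the last one is what
remains of 1, less d/n; this never exceeds the true coordinate (`mul_gridVec_digits_le`), and the
mass lost is at most d/n. Since rounding only lowers beliefs, the policy read off the table is worth
at least its table value (`Table.le_linValue`). Since no continuation is worth more than p/(1 - p)
and a round is survived with probability at most p, the losses add up to at most (d/n) p² / (1 - p)²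
(`Table.linValue_le`). This is at most ε once n ≥ d x.

A grid point is given by d natural numbers of sum at most n, and for n ≤ d x + 1 and x ≥ 4 there are
at most 2 (4x)^d of them (`card_le_of_sum_le`, `grid_bound`). The machine has neither a floor nor
integer products, so digits are found by counting. While counting, it builds by doublings an
injective integer code of the grid point. This code addresses an initially zero array that serves as
a dictionary, so one edge of the belief graph costs O(n + d) steps (`edgeProg_spec`). Value
iteration costs O(H |K|) per belief.

If p ≤ ε (1 - p), no policy is worth more than ε and the zero memory is an answer. Otherwise x > 1 /
(p (1 - p)) ≥ 4, so 4x ≤ x², and x^(2d) absorbs both 4^d and the factor x from n (`steps_bound`).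
This makes the constant absolute. -/

noncomputable section

/-! ### The value of a policy as a sum of products. -/

namespace RecAPC

/-- The expected number of likes, among the first `h` rounds, of a user whose probability to like
the recommendation of round `t` is `f t`. -/
def expectedLikes (f : ℕ → ℝ) (h : ℕ) : ℝ := ∑ j ∈ Finset.range h, ∏ t ∈ Finset.range (j + 1), f t

theorem expectedLikes_zero (f : ℕ → ℝ) : expectedLikes f 0 = 0 := by simp [expectedLikes]

theorem expectedLikes_succ (f : ℕ → ℝ) (h : ℕ) :
    expectedLikes f (h + 1) = f 0 * (1 + expectedLikes (fun t => f (t + 1)) h) := by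
  simp only [expectedLikes]
  rw [Finset.sum_range_succ', mul_add, Finset.mul_sum]
  simp only [Finset.prod_range_succ' _ (_ + 1), Finset.prod_range_succ' _ 0, Finset.range_zero,
    Finset.prod_empty]
  rw [add_comm, one_mul, mul_one]
  congr 1
  exact Finset.sum_congr rfl fun j _ => mul_comm _ _

theorem expectedLikes_nonneg {f : ℕ → ℝ} (hf : ∀ t, 0 ≤ f t) (h : ℕ) : 0 ≤ expectedLikes f h :=
  Finset.sum_nonneg fun _ _ => Finset.prod_nonneg fun _ _ => hf _

/-- The bound p/(1 - p) is the fixed point of y ↦ p (1 + y), so the recursion `expectedLikes_succ`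
preserves it, uniformly in the horizon. -/
theorem expectedLikes_le {p : ℝ} (hp : p < 1) (h : ℕ) :
    ∀ {f : ℕ → ℝ}, (∀ t, 0 ≤ f t) → (∀ t, f t ≤ p) → expectedLikes f h ≤ p / (1 - p) := by
  have h1 : (0 : ℝ) < 1 - p := by linarith
  induction h with
  | zero =>
    intro f hf hfp
    rw [expectedLikes_zero]
    exact div_nonneg ((hf 0).trans (hfp 0)) h1.le
  | succ h ih =>
    intro f hf hfp
    have hi := ih (f := fun t => f (t + 1)) (fun t => hf _) (fun t => hfp _)
    have hn := expectedLikes_nonneg (f := fun t => f (t + 1)) (fun t => hf _) h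
    rw [expectedLikes_succ]
    calc f 0 * (1 + expectedLikes (fun t => f (t + 1)) h)
        ≤ p * (1 + p / (1 - p)) := by
          apply mul_le_mul (hfp 0) (by linarith) (by linarith) ((hf 0).trans (hfp 0))
      _ = p / (1 - p) := by field_simp; ring

variable {K M : Type} [Fintype M]

/-- Truncation at H turns the possibly infinite count into a finite sum of indicators of cylinder
events, which can be integrated term by term. -/
theorem likes_min (ω : ℕ → Bool) (H : ℕ) :
    ((min (H : ℕ∞) (likes ω)).toNat : ℝ)
      = ∑ j ∈ Finset.range H, Set.indicator {ω : ℕ → Bool | ∀ s ≤ j, ω s = true} 1 ω := by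
  classical
  have hS : min (H : ℕ∞) (likes ω)
      = (((Finset.range H).filter fun j => ∀ s ≤ j, ω s = true).card : ℕ∞) := by
    unfold likes
    -- Without a dislike before round H the number of likes may be infinite, and the minimum is H;
    -- otherwise all counted rounds lie below H.
    by_cases hall : ∀ s < H, ω s = true
    · rw [Finset.filter_true_of_mem, Finset.card_range, min_eq_left]
      · have hsub : ((Finset.range H : Finset ℕ) : Set ℕ) ⊆ {t : ℕ | ∀ s ≤ t, ω s = true} := by
          intro t ht s hs
          simp only [Finset.coe_range, Set.mem_Iio] at ht
          exact hall s (by omega)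
        have := Set.encard_le_encard hsub
        rwa [Set.encard_coe_eq_coe_finsetCard, Finset.card_range] at this
      · intro j hj s hs
        exact hall s (by have := Finset.mem_range.1 hj; omega)
    · push Not at hall
      obtain ⟨r, hr, hω⟩ := hall
      have hset : {t : ℕ | ∀ s ≤ t, ω s = true}
          = (((Finset.range H).filter fun j => ∀ s ≤ j, ω s = true : Finset ℕ) : Set ℕ) := by
        ext t
        simp only [Set.mem_ofPred_eq, Finset.coe_filter, Finset.mem_range]
        refine ⟨fun h => ⟨?_, h⟩, fun h => h.2⟩
        by_contra hlt
        exact hω (h r (by omega))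
      rw [hset, Set.encard_coe_eq_coe_finsetCard, min_eq_right]
      exact_mod_cast (Finset.card_filter_le _ _).trans (Finset.card_range H).le
  rw [hS, ENat.toNat_natCast, Finset.card_filter]
  push_cast
  refine Finset.sum_congr rfl fun j _ => ?_
  simp [Set.indicator_apply]

theorem feedbackLaw_prefix (I : RecAPC K M) (π : Policy K) (m : M) (j : ℕ) :
    (I.feedbackLaw π m).real {ω : ℕ → Bool | ∀ s ≤ j, ω s = true}
      = ∏ t ∈ Finset.range (j + 1), (I.pref (π t) m : ℝ) := by
  have hset : {ω : ℕ → Bool | ∀ s ≤ j, ω s = true}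
      = Set.pi (Finset.range (j + 1) : Finset ℕ) fun _ => {true} := by
    ext ω
    simp [Set.mem_pi]
  rw [hset, measureReal_def, feedbackLaw, Measure.infinitePi_pi _ (fun _ _ => by measurability),
    ENNReal.toReal_prod]
  refine Finset.prod_congr rfl fun t _ => ?_
  rw [← measureReal_def, bernoulliMeasure_real_apply _ (by measurability)]
  simp

theorem value_eq (I : RecAPC K M) (H : ℕ) (π : Policy K) :
    I.value H π = ∑ m, I.prior m * expectedLikes (fun t => (I.pref (π t) m : ℝ)) H := by
  refine Finset.sum_congr rfl fun m _ => ?_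
  congr 1
  have hm : ∀ j, MeasurableSet {ω : ℕ → Bool | ∀ s ≤ j, ω s = true} := fun j => by
    have : {ω : ℕ → Bool | ∀ s ≤ j, ω s = true} = ⋂ s, ⋂ (_ : s ≤ j), {ω | ω s = true} := by
      ext; simp
    rw [this]
    exact MeasurableSet.iInter fun s => MeasurableSet.iInter fun _ =>
      measurableSet_eq_fun (measurable_pi_apply s) measurable_const
  have : IsProbabilityMeasure (I.feedbackLaw π m) := by unfold feedbackLaw; infer_instance
  simp only [likes_min]
  rw [integral_finsetSum]
  · refine Finset.sum_congr rfl fun j _ => ?_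
    rw [integral_indicator_one (hm j), feedbackLaw_prefix]
  · intro j _
    exact (integrable_const (1 : ℝ)).indicator (hm j)

end RecAPC

/-! ### Total correctness with step bounds, and a frame rule. -/

namespace RealRAM

/-- Started in `s`, the program `p` halts within `T` steps, in a memory that satisfies `Q`. -/
def Ends (p : Program) (s : Store) (T : ℕ) (Q : Store → Prop) : Prop :=
  ∃ t s', Runs p s t s' ∧ t ≤ T ∧ Q s'

theorem Ends.mono {p : Program} {s : Store} {T T' : ℕ} {Q Q' : Store → Prop}
    (h : Ends p s T Q) (hT : T ≤ T') (hQ : ∀ s', Q s' → Q' s') : Ends p s T' Q' := by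
  obtain ⟨t, s', hr, ht, hq⟩ := h
  exact ⟨t, s', hr, ht.trans hT, hQ s' hq⟩

theorem Ends.skip {s : Store} {T : ℕ} {Q : Store → Prop} (h : Q s) (hT : 1 ≤ T) :
    Ends .skip s T Q := ⟨1, s, .skip s, hT, h⟩

theorem Ends.assignNat {a : ℕ} {i e : NatExpr} {s : Store} {T : ℕ} {Q : Store → Prop}
    (h : Q (s.setNat a (i.eval s) (e.eval s))) (hT : i.cost + e.cost + 1 ≤ T) :
    Ends (.assignNat a i e) s T Q := ⟨_, _, .assignNat a i e s, hT, h⟩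

theorem Ends.assignReal {a : ℕ} {i : NatExpr} {e : RealExpr} {s : Store} {T : ℕ}
    {Q : Store → Prop} (h : Q (s.setReal a (i.eval s) (e.eval s)))
    (hT : i.cost + e.cost + 1 ≤ T) :
    Ends (.assignReal a i e) s T Q := ⟨_, _, .assignReal a i e s, hT, h⟩

theorem Ends.seq {p q : Program} {s : Store} {T T' : ℕ} {R Q : Store → Prop}
    (hp : Ends p s T R) (hq : ∀ s', R s' → Ends q s' T' Q) : Ends (.seq p q) s (T + T') Q := by
  obtain ⟨t, s', hr, ht, h⟩ := hp
  obtain ⟨t', s'', hr', ht', h'⟩ := hq s' h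
  exact ⟨t + t', s'', .seq hr hr', by omega, h'⟩

theorem Ends.seq_nat {a : ℕ} {i e : NatExpr} {q : Program} {s : Store} {T : ℕ}
    {Q : Store → Prop} (hq : Ends q (s.setNat a (i.eval s) (e.eval s)) T Q) :
    Ends (.seq (.assignNat a i e) q) s ((i.cost + e.cost + 1) + T) Q := by
  refine Ends.seq (R := fun s' => s' = s.setNat a (i.eval s) (e.eval s))
    (Ends.assignNat rfl le_rfl) ?_
  rintro _ rfl
  exact hq

theorem Ends.seq_real {a : ℕ} {i : NatExpr} {e : RealExpr} {q : Program} {s : Store} {T : ℕ}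
    {Q : Store → Prop} (hq : Ends q (s.setReal a (i.eval s) (e.eval s)) T Q) :
    Ends (.seq (.assignReal a i e) q) s ((i.cost + e.cost + 1) + T) Q := by
  refine Ends.seq (R := fun s' => s' = s.setReal a (i.eval s) (e.eval s))
    (Ends.assignReal rfl le_rfl) ?_
  rintro _ rfl
  exact hq

theorem Ends.cond {b : Test} {p q : Program} {s : Store} {T : ℕ} {Q : Store → Prop}
    (hp : b.Holds s → Ends p s T Q) (hq : ¬ b.Holds s → Ends q s T Q) :
    Ends (.cond b p q) s (b.cost + T) Q := by
  by_cases hb : b.Holds s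
  · obtain ⟨t, s', hr, ht, h⟩ := hp hb
    exact ⟨_, s', .cond_true q hb hr, by omega, h⟩
  · obtain ⟨t, s', hr, ht, h⟩ := hq hb
    exact ⟨_, s', .cond_false p hb hr, by omega, h⟩

/-- Induction on the number N - i of rounds that may remain; `hstep` must exclude a true test once i
reaches N. The alternative `l = i` covers a start beyond N. -/
theorem Ends.loop_from {b : Test} {p : Program} {Inv : ℕ → Store → Prop} {N : ℕ} {c : ℕ → ℕ}
    (hstep : ∀ i s, Inv i s → b.Holds s → i < N ∧ Ends p s (c i) (Inv (i + 1))) (d : ℕ) :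
    ∀ i s, N - i = d → Inv i s → Ends (.loop b p) s
      ((∑ l ∈ Finset.Ico i N, (b.cost + c l)) + b.cost)
      (fun s' => ∃ l, (l = i ∨ l ≤ N) ∧ Inv l s' ∧ ¬ b.Holds s') := by
  induction d with
  | zero =>
    intro i s hi hinv
    by_cases hb : b.Holds s
    · have := (hstep i s hinv hb).1
      omega
    · exact ⟨_, s, .loop_done p hb, by omega, i, Or.inl rfl, hinv, hb⟩
  | succ d ih =>
    intro i s hi hinv
    by_cases hb : b.Holds s
    · obtain ⟨hlt, t, s', hr, ht, hinv'⟩ := hstep i s hinv hb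
      obtain ⟨t', s'', hr', ht', l, hl, h⟩ := ih (i + 1) s' (by omega) hinv'
      refine ⟨_, s'', .loop_step hb hr hr', ?_, l, ?_, h⟩
      · rw [Finset.sum_eq_sum_Ico_succ_bot hlt]
        omega
      · omega
    · exact ⟨_, s, .loop_done p hb, by omega, i, Or.inl rfl, hinv, hb⟩

/-- The integer arrays to which a program writes. -/
def Program.natWrites : Program → List ℕ
  | .skip => []
  | .assignNat a _ _ => [a]
  | .assignReal _ _ _ => []
  | .seq p q => p.natWrites ++ q.natWrites
  | .cond _ p q => p.natWrites ++ q.natWrites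
  | .loop _ p => p.natWrites

/-- The real arrays to which a program writes. -/
def Program.realWrites : Program → List ℕ
  | .skip => []
  | .assignNat _ _ _ => []
  | .assignReal a _ _ => [a]
  | .seq p q => p.realWrites ++ q.realWrites
  | .cond _ p q => p.realWrites ++ q.realWrites
  | .loop _ p => p.realWrites

/-- Frame rule: invariants need only mention the arrays that a loop changes. For a concrete program
and array the hypothesis is decidable. -/
theorem Runs.nat_eq {p : Program} {s s' : Store} {t : ℕ} (h : Runs p s t s') {a : ℕ}
    (ha : a ∉ p.natWrites) : s'.nat a = s.nat a := by
  induction h with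
  | skip | assignReal | loop_done => rfl
  | assignNat b i e s =>
    simp only [Program.natWrites, List.mem_singleton] at ha
    simp [Store.setNat, Function.update_of_ne ha]
  | seq _ _ h1 h2 =>
    simp only [Program.natWrites, List.mem_append, not_or] at ha
    rw [h2 ha.2, h1 ha.1]
  | cond_true _ _ _ h1 =>
    simp only [Program.natWrites, List.mem_append, not_or] at ha
    exact h1 ha.1
  | cond_false _ _ _ h1 =>
    simp only [Program.natWrites, List.mem_append, not_or] at ha
    exact h1 ha.2
  | loop_step _ _ _ h1 h2 =>
    simp only [Program.natWrites] at ha h2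
    rw [h2 ha, h1 ha]

theorem Runs.real_eq {p : Program} {s s' : Store} {t : ℕ} (h : Runs p s t s') {a : ℕ}
    (ha : a ∉ p.realWrites) : s'.real a = s.real a := by
  induction h with
  | skip | assignNat | loop_done => rfl
  | assignReal b i e s =>
    simp only [Program.realWrites, List.mem_singleton] at ha
    simp [Store.setReal, Function.update_of_ne ha]
  | seq _ _ h1 h2 =>
    simp only [Program.realWrites, List.mem_append, not_or] at ha
    rw [h2 ha.2, h1 ha.1]
  | cond_true _ _ _ h1 =>
    simp only [Program.realWrites, List.mem_append, not_or] at ha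
    exact h1 ha.1
  | cond_false _ _ _ h1 =>
    simp only [Program.realWrites, List.mem_append, not_or] at ha
    exact h1 ha.2
  | loop_step _ _ _ h1 h2 =>
    simp only [Program.realWrites] at ha h2
    rw [h2 ha, h1 ha]

/-- The memories `s` and `s'` agree outside the arrays to which `p` writes. -/
structure Program.Keeps (p : Program) (s s' : Store) : Prop where
  nat : ∀ a ∉ p.natWrites, s'.nat a = s.nat a
  real : ∀ a ∉ p.realWrites, s'.real a = s.real a

theorem Ends.keeps {p : Program} {s : Store} {T : ℕ} {Q : Store → Prop} (h : Ends p s T Q) :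
    Ends p s T (fun s' => p.Keeps s s' ∧ Q s') := by
  obtain ⟨t, s', hr, ht, hq⟩ := h
  exact ⟨t, s', hr, ht, ⟨fun _ ha => hr.nat_eq ha, fun _ ha => hr.real_eq ha⟩, hq⟩

theorem Ends.seq_keeps {p q : Program} {s : Store} {T T' : ℕ} {R Q : Store → Prop}
    (hp : Ends p s T R) (hq : ∀ s', p.Keeps s s' → R s' → Ends q s' T' Q) :
    Ends (.seq p q) s (T + T') Q :=
  hp.keeps.seq fun s' h => hq s' h.1 h.2

theorem Program.Keeps.refl (p : Program) (s : Store) : p.Keeps s s :=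
  ⟨fun _ _ => rfl, fun _ _ => rfl⟩

theorem Program.Keeps.trans {p : Program} {s s' s'' : Store} (h : p.Keeps s s')
    (h' : p.Keeps s' s'') : p.Keeps s s'' :=
  ⟨fun a ha => (h'.nat a ha).trans (h.nat a ha), fun a ha => (h'.real a ha).trans (h.real a ha)⟩

/-- A loop with invariant `Inv i` after `i` rounds, at most `N` rounds, and at most `c i` steps in
round `i`. -/
theorem Ends.loop_sum {b : Test} {p : Program} (Inv : ℕ → Store → Prop) (N : ℕ) (c : ℕ → ℕ)
    {s₀ : Store} {Q : Store → Prop} (h0 : Inv 0 s₀)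
    (hstep : ∀ i s, p.Keeps s₀ s → Inv i s → b.Holds s → i < N ∧ Ends p s (c i) (Inv (i + 1)))
    (hQ : ∀ i s, p.Keeps s₀ s → i ≤ N → Inv i s → ¬ b.Holds s → Q s) :
    Ends (.loop b p) s₀ ((∑ i ∈ Finset.range N, (b.cost + c i)) + b.cost) Q := by
  have := Ends.loop_from (b := b) (p := p) (Inv := fun i s => p.Keeps s₀ s ∧ Inv i s) (N := N)
    (c := c) ?_ (N - 0) 0 s₀ rfl ⟨.refl p s₀, h0⟩
  · refine this.mono (by rw [Finset.range_eq_Ico]) ?_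
    rintro s' ⟨l, hl, ⟨hk, hinv⟩, hb⟩
    exact hQ l s' hk (by omega) hinv hb
  · rintro i s ⟨hk, hinv⟩ hb
    obtain ⟨hlt, h⟩ := hstep i s hk hinv hb
    exact ⟨hlt, h.keeps.mono le_rfl fun s' h' => ⟨hk.trans h'.1, h'.2⟩⟩

/-- A loop with invariant `Inv i` after `i` rounds, at most `N` rounds, and at most `c` steps per
round. -/
theorem Ends.loop {b : Test} {p : Program} (Inv : ℕ → Store → Prop) (N c : ℕ)
    {s₀ : Store} {Q : Store → Prop} (h0 : Inv 0 s₀)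
    (hstep : ∀ i s, p.Keeps s₀ s → Inv i s → b.Holds s → i < N ∧ Ends p s c (Inv (i + 1)))
    (hQ : ∀ i s, p.Keeps s₀ s → i ≤ N → Inv i s → ¬ b.Holds s → Q s) :
    Ends (.loop b p) s₀ (N * (b.cost + c) + b.cost) Q :=
  (Ends.loop_sum Inv N (fun _ => c) h0 hstep hQ).mono (by simp) fun _ h => h

theorem Store.nat_setNat (s : Store) (a i v b j : ℕ) :
    (s.setNat a i v).nat b j = if b = a ∧ j = i then v else s.nat b j := by
  by_cases hb : b = a
  · subst hb
    by_cases hj : j = i <;> simp [Store.setNat, Function.update, hj]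
  · simp [Store.setNat, Function.update, hb]

theorem Store.real_setReal (s : Store) (a i : ℕ) (v : ℝ) (b j : ℕ) :
    (s.setReal a i v).real b j = if b = a ∧ j = i then v else s.real b j := by
  by_cases hb : b = a
  · subst hb
    by_cases hj : j = i <;> simp [Store.setReal, Function.update, hj]
  · simp [Store.setReal, Function.update, hb]

theorem Store.nat_setNat_of_ne (s : Store) {a b : ℕ} (h : b ≠ a) (i v : ℕ) :
    (s.setNat a i v).nat b = s.nat b := Function.update_of_ne h _ _

theorem Store.real_setReal_of_ne (s : Store) {a b : ℕ} (h : b ≠ a) (i : ℕ) (v : ℝ) :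
    (s.setReal a i v).real b = s.real b := Function.update_of_ne h _ _

theorem Store.real_setNat (s : Store) (a i v : ℕ) : (s.setNat a i v).real = s.real := rfl

theorem Store.nat_setReal (s : Store) (a i : ℕ) (v : ℝ) : (s.setReal a i v).nat = s.nat := rfl

end RealRAM

/-! ## Rounding to a grid -/

namespace GridRounding

/-- The vector with `d + 1` entries that are multiples of `1 / n`; the first `d` of them are given
by `a`, and the last one is `1` minus the others, less `d / n`. -/
def gridVec (n d : ℕ) (a : ℕ → ℕ) (m : ℕ) : ℝ :=
  if m < d then (a m : ℝ) / n else ((n - ∑ i ∈ Finset.range d, a i - d : ℕ) : ℝ) / n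

/-- The number whose binary expansion lists the first `m` values of `a` in unary. -/
def code (a : ℕ → ℕ) : ℕ → ℕ
  | 0 => 0
  | m + 1 => 2 * ((code a m + 1) * 2 ^ a m - 1)

theorem even_code (a : ℕ → ℕ) (m : ℕ) : 2 ∣ code a m := by
  cases m with
  | zero => exact dvd_zero 2
  | succ m => exact Dvd.intro _ rfl

theorem odd_mul_two_pow_inj {u v : ℕ} (hu : ¬ 2 ∣ u) (hv : ¬ 2 ∣ v) :
    ∀ {a b : ℕ}, u * 2 ^ a = v * 2 ^ b → u = v ∧ a = b
  | 0, 0, h => by simpa using h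
  | 0, b + 1, h => by
    refine absurd ?_ hu
    rw [pow_zero, mul_one, pow_succ] at h
    exact ⟨v * 2 ^ b, by rw [h]; ring⟩
  | a + 1, 0, h => by
    refine absurd ?_ hv
    rw [pow_zero, mul_one, pow_succ] at h
    exact ⟨u * 2 ^ a, by rw [← h]; ring⟩
  | a + 1, b + 1, h => by
    have h' : u * 2 ^ a = v * 2 ^ b := by
      rw [pow_succ, pow_succ, ← mul_assoc, ← mul_assoc] at h
      exact Nat.eq_of_mul_eq_mul_right two_pos h
    have := odd_mul_two_pow_inj hu hv h'
    exact ⟨this.1, by rw [this.2]⟩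

/-- Codes are even, so `code a d + 1` is odd and the 2-adic valuation of (code a d + 1) 2^(a d) is
the last digit. Removing it leaves a shorter code. -/
theorem code_inj {a b : ℕ → ℕ} : ∀ {d : ℕ}, code a d = code b d → ∀ m < d, a m = b m
  | 0, _, m, hm => absurd hm (Nat.not_lt_zero m)
  | d + 1, h, m, hm => by
    have ha := even_code a d
    have hb := even_code b d
    have h1 : 0 < (code a d + 1) * 2 ^ a d := by positivity
    have h2 : 0 < (code b d + 1) * 2 ^ b d := by positivity
    have h3 : (code a d + 1) * 2 ^ a d = (code b d + 1) * 2 ^ b d := by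
      simp only [code] at h
      omega
    obtain ⟨hc, hd⟩ := odd_mul_two_pow_inj (by omega) (by omega) h3
    rcases Nat.lt_succ_iff_lt_or_eq.1 hm with hlt | rfl
    · exact code_inj (by omega) m hlt
    · exact hd

theorem code_congr {a b : ℕ → ℕ} : ∀ {d : ℕ}, (∀ m < d, a m = b m) → code a d = code b d
  | 0, _ => rfl
  | d + 1, h => by
    rw [code, code, code_congr fun m hm => h m (by omega), h d (by omega)]

theorem gridVec_congr {n d : ℕ} {a b : ℕ → ℕ} (h : ∀ m < d, a m = b m) :
    gridVec n d a = gridVec n d b := by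
  funext m
  unfold gridVec
  rw [Finset.sum_congr rfl fun i hi => h i (Finset.mem_range.1 hi)]
  split_ifs with hm
  · rw [h m hm]
  · rfl

theorem gridVec_nonneg (n d : ℕ) (a : ℕ → ℕ) (m : ℕ) : 0 ≤ gridVec n d a m := by
  unfold gridVec
  split_ifs <;> positivity

theorem sum_gridVec (n d : ℕ) (a : ℕ → ℕ) :
    ∑ m ∈ Finset.range (d + 1), gridVec n d a m
      = ((∑ i ∈ Finset.range d, a i + (n - ∑ i ∈ Finset.range d, a i - d) : ℕ) : ℝ) / n := by
  rw [Finset.sum_range_succ]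
  have : ∀ m ∈ Finset.range d, gridVec n d a m = (a m : ℝ) / n := fun m hm => by
    simp [gridVec, Finset.mem_range.1 hm]
  rw [Finset.sum_congr rfl this, ← Finset.sum_div, gridVec, if_neg (lt_irrefl d), ← add_div]
  push_cast
  rfl

theorem sum_gridVec_le_one {n d : ℕ} {a : ℕ → ℕ} (ha : ∑ i ∈ Finset.range d, a i ≤ n) :
    ∑ m ∈ Finset.range (d + 1), gridVec n d a m ≤ 1 := by
  rw [sum_gridVec]
  refine div_le_one_of_le₀ ?_ (by positivity)
  exact_mod_cast (by omega)

/-- The rounding of the normalization of `Z`. -/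
def digits (n : ℕ) (r : ℝ) (Z : ℕ → ℝ) (m : ℕ) : ℕ := ⌊(n : ℝ) * (Z m / r)⌋₊

section

variable {n d : ℕ} {Z : ℕ → ℝ} {r : ℝ}

theorem sum_digits_le (hZ : ∀ m < d + 1, 0 ≤ Z m) (hr : r = ∑ m ∈ Finset.range (d + 1), Z m) :
    ∑ i ∈ Finset.range d, digits n r Z i ≤ n := by
  have hr0 : 0 ≤ r := hr ▸ Finset.sum_nonneg fun m hm => hZ m (Finset.mem_range.1 hm)
  have h1 : (∑ i ∈ Finset.range d, (digits n r Z i : ℝ)) ≤ n := by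
    calc (∑ i ∈ Finset.range d, (digits n r Z i : ℝ))
        ≤ ∑ i ∈ Finset.range d, (n : ℝ) * (Z i / r) := Finset.sum_le_sum fun i hi =>
          Nat.floor_le (mul_nonneg (Nat.cast_nonneg n)
            (div_nonneg (hZ i ((Finset.mem_range.1 hi).trans d.lt_succ_self)) hr0))
      _ = n * ((∑ i ∈ Finset.range d, Z i) / r) := by rw [← Finset.mul_sum, Finset.sum_div]
      _ ≤ n * 1 := by
        refine mul_le_mul_of_nonneg_left ?_ (Nat.cast_nonneg n)
        refine div_le_one_of_le₀ ?_ hr0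
        rw [hr, Finset.sum_range_succ]
        linarith [hZ d d.lt_succ_self]
      _ = n := mul_one _
  exact_mod_cast h1

/-- For the first d coordinates this is the floor. For the last, each floor loses at most 1, so n
minus the d digits and minus d is at most n minus the exact scaled coordinates. Subtracting d
instead of rounding the last coordinate separately lets d digits determine the whole vector. -/
theorem mul_gridVec_digits_le (hn : 0 < n) (hZ : ∀ m < d + 1, 0 ≤ Z m)
    (hr : r = ∑ m ∈ Finset.range (d + 1), Z m) {m : ℕ} (hm : m < d + 1) :
    r * gridVec n d (digits n r Z) m ≤ Z m := by
  have hr0 : 0 ≤ r := hr ▸ Finset.sum_nonneg fun m hm => hZ m (Finset.mem_range.1 hm)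
  -- If r = 0, the quotients `Z m / r` are 0 by convention and the grid vector is meaningless, but
  -- the factor r annihilates it.
  rcases hr0.eq_or_lt with h0 | hpos
  · rw [← h0, zero_mul]
    exact hZ m hm
  have hn' : (0 : ℝ) < n := by exact_mod_cast hn
  rw [mul_comm, ← le_div_iff₀ hpos]
  unfold gridVec
  split_ifs with hlt
  · rw [div_le_iff₀ hn', mul_comm]
    exact Nat.floor_le (mul_nonneg hn'.le (div_nonneg (hZ m hm) hr0))
  · obtain rfl : m = d := by omega
    rw [div_le_iff₀ hn']
    -- In the other case the truncated subtraction makes the last coordinate 0.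
    by_cases hsub : ∑ i ∈ Finset.range m, digits n r Z i + m ≤ n
    · have h1 : (n : ℝ) - (∑ i ∈ Finset.range m, (n : ℝ) * (Z i / r)) = Z m / r * n := by
        rw [← Finset.mul_sum, ← Finset.sum_div]
        have : ∑ i ∈ Finset.range m, Z i = r - Z m := by
          rw [hr, Finset.sum_range_succ]; ring
        rw [this]
        field_simp
        ring
      have h2 : ∑ i ∈ Finset.range m, (n : ℝ) * (Z i / r)
          ≤ ∑ i ∈ Finset.range m, ((digits n r Z i : ℝ) + 1) :=
        Finset.sum_le_sum fun i _ => (Nat.lt_floor_add_one _).le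
      rw [Finset.sum_add_distrib, Finset.sum_const, Finset.card_range, nsmul_eq_mul, mul_one] at h2
      rw [Nat.sub_sub, Nat.cast_sub hsub]
      push_cast
      linarith
    · rw [Nat.sub_sub, Nat.sub_eq_zero_of_le (by omega), Nat.cast_zero]
      exact mul_nonneg (div_nonneg (hZ m hm) hr0) hn'.le

/-- The mass is short of 1 by at most the d units that were subtracted; truncation at 0 can only add
mass. -/
theorem sub_mul_sum_gridVec_le {a : ℕ → ℕ} (hn : 0 < n) (hr : 0 ≤ r) :
    r - r * ∑ m ∈ Finset.range (d + 1), gridVec n d a m ≤ r * ((d : ℝ) / n) := by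
  have hn' : (0 : ℝ) < n := by exact_mod_cast hn
  have h : (1 : ℝ) - ∑ m ∈ Finset.range (d + 1), gridVec n d a m ≤ (d : ℝ) / n := by
    rw [sum_gridVec, sub_le_iff_le_add, ← add_div, one_le_div hn']
    exact_mod_cast (by omega)
  calc _ = r * (1 - ∑ m ∈ Finset.range (d + 1), gridVec n d a m) := by ring
    _ ≤ _ := mul_le_mul_of_nonneg_left h hr

end

/-- The number of points of the grid, estimated by a generating function. -/
theorem card_le_of_sum_le {n d : ℕ} {x : ℝ} (hx : 0 < x) (T : Finset (Fin d → ℕ))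
    (hT : ∀ a ∈ T, ∑ i, a i ≤ n) : (T.card : ℝ) ≤ ((x + 1) / x) ^ n * (x + 1) ^ d := by
  -- Every tuple in `T` has weight z^(Σ a) ≥ z^n, while all tuples together weigh at most (1 -
  -- z)^(-d) = (x + 1)^d. With this z a geometric digit has mean z / (1 - z) = x, which suits n ≈ d
  -- x.
  set z : ℝ := x / (x + 1) with hz
  have hx1 : 0 < x + 1 := by linarith
  have hz0 : 0 < z := div_pos hx hx1
  have hz1 : z < 1 := (div_lt_one hx1).2 (by linarith)
  have hsub : T ⊆ Fintype.piFinset fun _ : Fin d => Finset.range (n + 1) := by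
    intro a ha
    refine Fintype.mem_piFinset.2 fun i => Finset.mem_range.2 ?_
    have := Finset.single_le_sum (f := a) (fun _ _ => Nat.zero_le _) (Finset.mem_univ i)
    have := hT a ha
    omega
  have h1 : (T.card : ℝ) * z ^ n ≤ (x + 1) ^ d := by
    calc (T.card : ℝ) * z ^ n = ∑ a ∈ T, z ^ n := by rw [Finset.sum_const, nsmul_eq_mul]
      _ ≤ ∑ a ∈ T, ∏ i, z ^ a i := Finset.sum_le_sum fun a ha => by
          rw [Finset.prod_pow_eq_pow_sum]
          exact pow_le_pow_of_le_one hz0.le hz1.le (hT a ha)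
      _ ≤ ∑ a ∈ Fintype.piFinset fun _ : Fin d => Finset.range (n + 1), ∏ i, z ^ a i :=
          Finset.sum_le_sum_of_subset_of_nonneg hsub fun _ _ _ =>
            Finset.prod_nonneg fun _ _ => by positivity
      _ = ∏ _i : Fin d, ∑ j ∈ Finset.range (n + 1), z ^ j :=
          (Finset.prod_univ_sum (fun _ : Fin d => Finset.range (n + 1)) fun _ j => z ^ j).symm
      _ = (∑ j ∈ Finset.range (n + 1), z ^ j) ^ d := by simp
      _ ≤ (x + 1) ^ d := by
          refine pow_le_pow_left₀ (Finset.sum_nonneg fun _ _ => by positivity) ?_ d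
          have h2 : ∑ j ∈ Finset.range (n + 1), z ^ j ≤ (1 - z)⁻¹ := by
            rw [← tsum_geometric_of_lt_one hz0.le hz1]
            exact (summable_geometric_of_lt_one hz0.le hz1).sum_le_tsum _
              fun _ _ => by positivity
          refine h2.trans (le_of_eq ?_)
          rw [hz]
          field_simp
          ring
  have h3 : (x + 1) / x = z⁻¹ := by rw [hz, inv_div]
  rw [h3, inv_pow, mul_comm, ← div_eq_mul_inv, le_div_iff₀ (by positivity)]
  exact h1

/-- (1 + 1/x)^n ≤ e^(n/x) ≤ e^(1/4) e^d, and e (x + 1) ≤ 4x for x ≥ 4. -/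
theorem grid_bound {n d : ℕ} {x : ℝ} (hx : 4 ≤ x) (hn : (n : ℝ) ≤ d * x + 1) :
    ((x + 1) / x) ^ n * (x + 1) ^ d ≤ 2 * (4 * x) ^ d := by
  have hx0 : 0 < x := by linarith
  have h1 : ((x + 1) / x) ^ n ≤ Real.exp (1 / 4) * Real.exp 1 ^ d := by
    calc ((x + 1) / x) ^ n ≤ Real.exp (1 / x) ^ n := by
          refine pow_le_pow_left₀ (by positivity) ?_ n
          have := Real.add_one_le_exp (1 / x)
          rw [add_div, div_self hx0.ne']
          linarith
      _ = Real.exp (n * (1 / x)) := (Real.exp_nat_mul _ _).symm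
      _ ≤ Real.exp (1 / 4 + d * 1) := by
          refine Real.exp_le_exp.2 ?_
          rw [mul_one_div, div_le_iff₀ hx0]
          nlinarith
      _ = _ := by rw [Real.exp_add, Real.exp_nat_mul]
  have h2 : Real.exp (1 / 4) ≤ 2 := by
    have h3 : Real.exp (1 / 4) ^ 4 ≤ 2 ^ 4 := by
      rw [← Real.exp_nat_mul]
      norm_num
      linarith [Real.exp_one_lt_d9]
    exact le_of_pow_le_pow_left₀ (by norm_num) (by norm_num) h3
  calc ((x + 1) / x) ^ n * (x + 1) ^ d
      ≤ (Real.exp (1 / 4) * Real.exp 1 ^ d) * (x + 1) ^ d :=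
        mul_le_mul_of_nonneg_right h1 (by positivity)
    _ = Real.exp (1 / 4) * (Real.exp 1 * (x + 1)) ^ d := by rw [mul_pow]; ring
    _ ≤ 2 * (4 * x) ^ d := by
        refine mul_le_mul h2 ?_ (by positivity) (by norm_num)
        refine pow_le_pow_left₀ (by positivity) ?_ d
        nlinarith [Real.exp_one_lt_d9]

end GridRounding

/-! ## Approximate dynamic programming -/

namespace ApproxDP

open RecAPC

/-- The value of the policy `π` for horizon `h`, as a linear function of the weights of the
types. -/
def linValue (M : ℕ) (P : ℕ → ℕ → ℝ) (h : ℕ) (π : ℕ → ℕ) (w : ℕ → ℝ) : ℝ :=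
  ∑ m ∈ Finset.range M, w m * expectedLikes (fun t => P (π t) m) h

/-- Value iteration on a finite set of belief vectors: `S j` is the belief vector of state `j`, and
after a like of recommendation `k`, which has probability `R j k`, the belief is rounded to that of
state `E j k`. The optimal expected number of likes in `h` rounds is `U h j`. -/
structure Table (M K cnt : ℕ) (P S : ℕ → ℕ → ℝ) (E : ℕ → ℕ → ℕ) (R : ℕ → ℕ → ℝ) (δ : ℝ) :
    Prop where
  next_lt : ∀ j < cnt, ∀ k < K, E j k < cnt
  prob : ∀ j < cnt, ∀ k < K, R j k = ∑ m ∈ Finset.range M, S j m * P k m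
  le : ∀ j < cnt, ∀ k < K, ∀ m < M, R j k * S (E j k) m ≤ S j m * P k m
  loss : ∀ j < cnt, ∀ k < K,
    R j k - R j k * ∑ m ∈ Finset.range M, S (E j k) m ≤ R j k * δ
  nonneg : ∀ j < cnt, ∀ m < M, 0 ≤ S j m
  sum_le : ∀ j < cnt, ∑ m ∈ Finset.range M, S j m ≤ 1

variable {M K cnt : ℕ} {P S : ℕ → ℕ → ℝ} {E : ℕ → ℕ → ℕ} {R : ℕ → ℕ → ℝ} {δ p : ℝ}

theorem linValue_succ (h : ℕ) (π : ℕ → ℕ) (w : ℕ → ℝ) :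
    linValue M P (h + 1) π w = ∑ m ∈ Finset.range M, w m * P (π 0) m
      + linValue M P h (fun t => π (t + 1)) (fun m => w m * P (π 0) m) := by
  simp only [linValue, expectedLikes_succ, ← Finset.sum_add_distrib]
  exact Finset.sum_congr rfl fun m _ => by ring

theorem Table.prob_bounds (T : Table M K cnt P S E R δ) (hP0 : ∀ k < K, ∀ m < M, 0 ≤ P k m)
    (hP : ∀ k < K, ∀ m < M, P k m ≤ p) (hp : 0 ≤ p) {j k : ℕ} (hj : j < cnt) (hk : k < K) :
    0 ≤ R j k ∧ R j k ≤ p := by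
  rw [T.prob j hj k hk]
  refine ⟨Finset.sum_nonneg fun m hm => mul_nonneg (T.nonneg j hj m (Finset.mem_range.1 hm))
    (hP0 k hk m (Finset.mem_range.1 hm)), ?_⟩
  calc ∑ m ∈ Finset.range M, S j m * P k m ≤ ∑ m ∈ Finset.range M, S j m * p :=
        Finset.sum_le_sum fun m hm => mul_le_mul_of_nonneg_left (hP k hk m (Finset.mem_range.1 hm))
          (T.nonneg j hj m (Finset.mem_range.1 hm))
    _ = (∑ m ∈ Finset.range M, S j m) * p := (Finset.sum_mul ..).symm
    _ ≤ 1 * p := mul_le_mul_of_nonneg_right (T.sum_le j hj) hp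
    _ = p := one_mul p

/-- Rounding after a like removes mass at most R δ, and a unit of mass is worth at most p/(1 - p).
An error e for the remaining rounds thus becomes at most p (e + δ p/(1 - p)), and the stated error
is the fixed point, whatever the horizon. -/
theorem Table.linValue_le (T : Table M K cnt P S E R δ) (hP0 : ∀ k < K, ∀ m < M, 0 ≤ P k m)
    (hP : ∀ k < K, ∀ m < M, P k m ≤ p) (hp : 0 ≤ p) (hp1 : p < 1) (hδ : 0 ≤ δ)
    {U : ℕ → ℕ → ℝ} (hU0 : ∀ j, 0 ≤ U 0 j) (H : ℕ)
    (hU : ∀ h < H, ∀ j < cnt, ∀ k < K, R j k * (1 + U h (E j k)) ≤ U (h + 1) j) {h : ℕ}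
    (hh : h ≤ H) :
    ∀ {j : ℕ}, j < cnt → ∀ {π : ℕ → ℕ}, (∀ t, π t < K) →
      linValue M P h π (S j) ≤ U h j + δ * p * (p / (1 - p)) / (1 - p) := by
  have h1p : 0 < 1 - p := by linarith
  set L := p / (1 - p) with hL
  have hL0 : 0 ≤ L := div_nonneg hp h1p.le
  set e := δ * p * L / (1 - p) with he
  have he0 : 0 ≤ e := by positivity
  have hfix : p * (e + δ * L) = e := by rw [he]; field_simp; ring
  induction h with
  | zero =>
    intro j hj π hπ
    simp only [linValue, expectedLikes_zero, mul_zero, Finset.sum_const_zero]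
    linarith [hU0 j]
  | succ h ih =>
    intro j hj π hπ
    set k := π 0
    have hk : k < K := hπ 0
    obtain ⟨hr0, hrp⟩ := T.prob_bounds hP0 hP hp hj hk
    have hE := T.next_lt j hj k hk
    have hIH := ih (by omega) hE (π := fun t => π (t + 1)) fun t => hπ _
    rw [linValue_succ, ← T.prob j hj k hk]
    have hstep : linValue M P h (fun t => π (t + 1)) (fun m => S j m * P k m)
        ≤ R j k * linValue M P h (fun t => π (t + 1)) (S (E j k)) + R j k * δ * L := by
      simp only [linValue]
      rw [Finset.mul_sum, ← sub_le_iff_le_add', ← Finset.sum_sub_distrib]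
      calc ∑ m ∈ Finset.range M,
            (S j m * P k m * expectedLikes (fun t => P (π (t + 1)) m) h
              - R j k * (S (E j k) m * expectedLikes (fun t => P (π (t + 1)) m) h))
          ≤ ∑ m ∈ Finset.range M, (S j m * P k m - R j k * S (E j k) m) * L := by
            refine Finset.sum_le_sum fun m hm => ?_
            have hm' := Finset.mem_range.1 hm
            rw [← mul_assoc, ← sub_mul]
            refine mul_le_mul_of_nonneg_left ?_ (sub_nonneg.2 (T.le j hj k hk m hm'))
            exact expectedLikes_le hp1 h (fun t => hP0 _ (hπ _) m hm') fun t => hP _ (hπ _) m hm'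
        _ = (R j k - R j k * ∑ m ∈ Finset.range M, S (E j k) m) * L := by
            rw [← Finset.sum_mul, Finset.sum_sub_distrib, ← T.prob j hj k hk, Finset.mul_sum]
        _ ≤ R j k * δ * L := mul_le_mul_of_nonneg_right (T.loss j hj k hk) hL0
    have h2 := mul_le_mul_of_nonneg_left hIH hr0
    have h3 := hU h (by omega) j hj k hk
    have h4 : R j k * (e + δ * L) ≤ e :=
      (mul_le_mul_of_nonneg_right hrp (by positivity)).trans hfix.le
    linarith

/-- Along the visited states `cur` the table is exact except for the rounding. Rounded beliefs lie
below the true ones and likes are nonnegative, so the policy does at least as well as the table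
promises. -/
theorem Table.le_linValue (T : Table M K cnt P S E R δ) (hP0 : ∀ k < K, ∀ m < M, 0 ≤ P k m)
    {U : ℕ → ℕ → ℝ} (hU0 : ∀ j < cnt, U 0 j = 0) {cur π : ℕ → ℕ} (hπ : ∀ t, π t < K) {H : ℕ}
    (hcur : ∀ t < H, cur t < cnt)
    (hnext : ∀ t, t + 1 < H → cur (t + 1) = E (cur t) (π t))
    (hU : ∀ t < H, U (H - t) (cur t)
      = R (cur t) (π t) * (1 + U (H - (t + 1)) (E (cur t) (π t)))) (h : ℕ) :
    ∀ t < H, t + h = H → U h (cur t) ≤ linValue M P h (fun s => π (t + s)) (S (cur t)) := by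
  induction h with
  | zero =>
    intro t ht h
    omega
  | succ h ih =>
    intro t ht hth
    have hUt := hU t ht
    have e1 : H - t = h + 1 := by omega
    have e2 : H - (t + 1) = h := by omega
    rw [e1, e2] at hUt
    have hj := hcur t ht
    have hk := hπ t
    have hE := T.next_lt _ hj _ hk
    have hr0 : 0 ≤ R (cur t) (π t) := by
      rw [T.prob _ hj _ hk]
      exact Finset.sum_nonneg fun m hm => mul_nonneg (T.nonneg _ hj m (Finset.mem_range.1 hm))
        (hP0 _ hk m (Finset.mem_range.1 hm))
    have hIH : U h (E (cur t) (π t))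
        ≤ linValue M P h (fun s => π (t + 1 + s)) (S (E (cur t) (π t))) := by
      -- After the last round `cur` is not controlled any more, so horizon 0 is treated by `hU0`.
      rcases Nat.eq_zero_or_pos h with rfl | hpos
      · rw [hU0 _ hE]
        simp [linValue, expectedLikes_zero]
      · have := ih (t + 1) (by omega) (by omega)
        rwa [hnext t (by omega)] at this
    rw [hUt, linValue_succ, mul_add, mul_one]
    simp only [add_zero]
    rw [← T.prob _ hj _ hk]
    refine add_le_add le_rfl ((mul_le_mul_of_nonneg_left hIH hr0).trans ?_)
    have hfun : (fun s => π (t + 1 + s)) = fun s => π (t + (s + 1)) := by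
      funext s; congr 1; ring
    rw [hfun]
    simp only [linValue]
    rw [Finset.mul_sum]
    refine Finset.sum_le_sum fun m hm => ?_
    have hm' := Finset.mem_range.1 hm
    rw [← mul_assoc]
    exact mul_le_mul_of_nonneg_right (T.le _ hj _ hk m hm')
      (expectedLikes_nonneg (fun s => hP0 _ (hπ _) m hm') h)

end ApproxDP

/-! ### Programs for the size, the maximum, the resolution, a probability and a digit. -/

namespace RealRAM

/-- The first cell of an integer array, used as a variable. -/
abbrev NatExpr.var (a : ℕ) : NatExpr := .get a (.const 0)

/-- The first cell of a real array, used as a variable. -/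
abbrev RealExpr.var (a : ℕ) : RealExpr := .get a (.const 0)

/-- Assignment to an integer variable. -/
abbrev Program.set (a : ℕ) (e : NatExpr) : Program := .assignNat a (.const 0) e

/-- Increment of an integer variable. -/
abbrev Program.inc (a : ℕ) (e : NatExpr) : Program := .set a (.add (.var a) e)

/-- The number of user types. -/
abbrev NatExpr.types : NatExpr := .get 0 (.const 2)

/-- The number of categories. -/
abbrev NatExpr.categories : NatExpr := .get 0 (.const 1)

/-- The horizon. -/
abbrev NatExpr.horizon : NatExpr := .get 0 (.const 0)

open NatExpr Program

/-- Computes the size of the preference matrix in variable `3`. -/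
def sizeProg : Program :=
  .loop (.natLt (var 2) categories) (.seq (inc 3 types) (inc 2 (.const 1)))

/-- Computes the largest entry of the preference matrix in real variable `3`. -/
def maxProg : Program :=
  .loop (.natLt (var 4) (var 3))
    (.seq (.cond (.realLt (.var 3) (.get 0 (var 4))) (.assignReal 3 (.const 0) (.get 0 (var 4)))
      .skip) (inc 4 (.const 1)))

theorem sizeProg_spec {s : Store} (h2 : s.nat 2 0 = 0) (h3 : s.nat 3 0 = 0) :
    Ends sizeProg s (s.nat 0 1 * 18 + 5) fun s' => s'.nat 3 0 = s.nat 0 1 * s.nat 0 2 := by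
  refine (Ends.loop (fun i s' => s'.nat 2 0 = i ∧ i ≤ s.nat 0 1 ∧ s'.nat 3 0 = i * s.nat 0 2)
    (s.nat 0 1) 13 ?_ ?_ ?_).mono ?_ fun _ h => h
  · simp [h2, h3]
  · rintro i s' hk ⟨hi, -, hs⟩ hb
    have h0 := hk.nat 0 (by decide)
    simp only [Test.Holds, NatExpr.eval, hi, h0] at hb
    refine ⟨hb, (Ends.seq_nat (Ends.assignNat (T := 6) ?_ ?_)).mono ?_ fun _ h => h⟩
    · simp [NatExpr.eval, Store.nat_setNat, hi, hs, h0]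
      refine ⟨hb, by ring⟩
    · simp [NatExpr.cost]
    · simp [NatExpr.cost]
  · rintro i s' hk - ⟨hi, hle, hs⟩ hb
    simp only [Test.Holds, NatExpr.eval, hi, hk.nat 0 (by decide)] at hb
    rw [hs, show i = s.nat 0 1 by omega]
  · simp [Test.cost, NatExpr.cost]

theorem maxProg_spec {s : Store} (h4 : s.nat 4 0 = 0) (h3 : s.real 3 0 = 0) :
    Ends maxProg s (s.nat 3 0 * 24 + 5) fun s' =>
      (∀ i < s.nat 3 0, s.real 0 i ≤ s'.real 3 0) ∧ 0 ≤ s'.real 3 0 ∧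
        (s'.real 3 0 = 0 ∨ ∃ i < s.nat 3 0, s'.real 3 0 = s.real 0 i) := by
  refine (Ends.loop (fun i s' => s'.nat 4 0 = i ∧ i ≤ s.nat 3 0 ∧
      (∀ l < i, s.real 0 l ≤ s'.real 3 0) ∧ 0 ≤ s'.real 3 0 ∧
        (s'.real 3 0 = 0 ∨ ∃ l < s.nat 3 0, s'.real 3 0 = s.real 0 l))
    (s.nat 3 0) 19 ?_ ?_ ?_).mono ?_ fun _ h => h
  · simp [h3, h4]
  · rintro i s' hk ⟨hi, -, hl, hp, hm⟩ hb
    have h0 := hk.real 0 (by decide)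
    have h3 := hk.nat 3 (by decide)
    simp only [Test.Holds, NatExpr.eval, hi, h3] at hb
    refine ⟨hb, ((Ends.cond (T := 6) (Q := fun s'' => s''.nat 4 0 = i ∧
      (∀ l < i + 1, s.real 0 l ≤ s''.real 3 0) ∧ 0 ≤ s''.real 3 0 ∧
        (s''.real 3 0 = 0 ∨ ∃ l < s.nat 3 0, s''.real 3 0 = s.real 0 l)) ?_ ?_).seq
        (T' := 6) ?_).mono ?_ fun _ h => h⟩
    · intro hlt
      refine Ends.assignReal ?_ (by simp [NatExpr.cost, RealExpr.cost])
      simp only [Test.Holds, RealExpr.eval, NatExpr.eval, hi, h0] at hlt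
      simp only [Store.nat_setReal, Store.real_setReal, RealExpr.eval, NatExpr.eval, hi, h0,
        and_self, if_true, true_and]
      refine ⟨fun l hl' => ?_, hp.trans hlt.le, Or.inr ⟨i, hb, rfl⟩⟩
      rcases Nat.lt_succ_iff_lt_or_eq.1 hl' with h | rfl
      · exact (hl l h).trans hlt.le
      · exact le_rfl
    · intro hlt
      refine Ends.skip ⟨hi, fun l hl' => ?_, hp, hm⟩ (by norm_num)
      simp only [Test.Holds, RealExpr.eval, NatExpr.eval, hi, h0, not_lt] at hlt
      rcases Nat.lt_succ_iff_lt_or_eq.1 hl' with h | rfl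
      · exact hl l h
      · exact hlt
    · rintro s'' ⟨hi', h⟩
      refine Ends.assignNat ?_ (by simp [NatExpr.cost])
      simp only [Store.nat_setNat, Store.real_setNat, NatExpr.eval, hi', and_self, if_true,
        true_and]
      exact ⟨hb, h⟩
    · simp [NatExpr.cost, RealExpr.cost, Test.cost]
  · rintro i s' hk - ⟨hi, hle, hl, h⟩ hb
    simp only [Test.Holds, NatExpr.eval, hi, hk.nat 3 (by decide)] at hb
    exact ⟨fun l h' => hl l (by omega), h⟩
  · simp [Test.cost, NatExpr.cost]

/-- Computes the resolution of the grid in variable `5`. -/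
def gridProg : Program :=
  .seq (set 5 (.const 1))
    (.loop (.realLt (.mul (.cast (var 5)) (.mul (.var 2)
        (.mul (.sub (.cast (.const 1)) (.var 3)) (.sub (.cast (.const 1)) (.var 3)))))
      (.cast (.sub types (.const 1)))) (inc 5 (.const 1)))

/-- Counting up to the first n with d ≤ n y replaces a ceiling. The start at 1 keeps n positive when
d = 0. -/
theorem gridProg_spec {s : Store} {y : ℝ}
    (hy : y = s.real 2 0 * ((1 - s.real 3 0) * (1 - s.real 3 0))) (hy0 : 0 < y) {d : ℕ}
    (hd : s.nat 0 2 = d + 1) :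
    Ends gridProg s (⌈(d : ℝ) / y⌉₊ * 32 + 40) fun s' => 1 ≤ s'.nat 5 0 ∧
      (d : ℝ) ≤ s'.nat 5 0 * y ∧ (s'.nat 5 0 : ℝ) ≤ d / y + 1 := by
  refine (Ends.seq_nat (Ends.loop (fun i s' => s'.nat 5 0 = i + 1 ∧ (i : ℝ) ≤ d / y)
    ⌈(d : ℝ) / y⌉₊ 6 ?_ ?_ ?_)).mono ?_ fun _ h => h
  · simp only [NatExpr.eval, Store.nat_setNat, and_self, if_true, zero_add, true_and,
      Nat.cast_zero]
    positivity
  · rintro i s' hk ⟨hi, -⟩ hb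
    have h0 := hk.nat 0 (by decide)
    have h2 := hk.real 2 (by decide)
    have h3 := hk.real 3 (by decide)
    simp only [Test.Holds, NatExpr.eval, RealExpr.eval, hi, h0, h2, h3, Store.real_setNat,
      Store.nat_setNat] at hb
    norm_num [hd, ← hy] at hb
    rw [← lt_div_iff₀ hy0] at hb
    refine ⟨Nat.lt_ceil.2 (by linarith), Ends.assignNat ?_ (by simp [NatExpr.cost])⟩
    simp only [NatExpr.eval, Store.nat_setNat, and_self, if_true, hi, true_and]
    push_cast
    exact hb.le
  · rintro i s' hk - ⟨hi, hle⟩ hb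
    have h0 := hk.nat 0 (by decide)
    have h2 := hk.real 2 (by decide)
    have h3 := hk.real 3 (by decide)
    simp only [Test.Holds, NatExpr.eval, RealExpr.eval, hi, h0, h2, h3, Store.real_setNat,
      Store.nat_setNat] at hb
    norm_num [hd, ← hy] at hb
    rw [hi]
    refine ⟨by omega, ?_⟩
    push_cast
    exact ⟨hb, by linarith⟩
  · simp only [Test.cost, NatExpr.cost, RealExpr.cost]
    omega

/-- Computes in real variable `4` the probability that a user with belief vector `9` likes
recommendation `11`. -/
def probProg : Program :=
  .seq (.assignReal 4 (.const 0) (.cast (.const 0)))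
    (.seq (set 12 (.const 0))
      (.loop (.natLt (var 12) types)
        (.seq (.assignReal 4 (.const 0) (.add (.var 4)
            (.mul (.get 1 (.add (var 9) (var 12))) (.get 0 (.add (var 11) (var 12))))))
          (inc 12 (.const 1)))))

theorem probProg_spec {s : Store} :
    Ends probProg s (s.nat 0 2 * 40 + 20) fun s' => s'.real 4 0 =
      ∑ m ∈ Finset.range (s.nat 0 2),
        s.real 1 (s.nat 9 0 + m) * s.real 0 (s.nat 11 0 + m) := by
  refine (Ends.seq_real (Ends.seq_nat (Ends.loop (fun i s' => s'.nat 12 0 = i ∧ i ≤ s.nat 0 2 ∧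
    s'.real 4 0 = ∑ m ∈ Finset.range i,
        s.real 1 (s.nat 9 0 + m) * s.real 0 (s.nat 11 0 + m))
    (s.nat 0 2) 25 ?_ ?_ ?_))).mono ?_ fun _ h => h
  · simp [NatExpr.eval, RealExpr.eval, Store.nat_setNat, Store.real_setNat, Store.real_setReal]
  · rintro i s' hk ⟨hi, -, hr⟩ hb
    have h0 := hk.nat 0 (by decide)
    have h9 := hk.nat 9 (by decide)
    have h11 := hk.nat 11 (by decide)
    have r0 := hk.real 0 (by decide)
    have r1 := hk.real 1 (by decide)
    simp only [Test.Holds, NatExpr.eval, hi, h0] at hb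
    simp [Store.nat_setNat, Store.nat_setReal] at hb
    refine ⟨hb, (Ends.seq_real (Ends.assignNat (T := 6) ?_ (by simp [NatExpr.cost]))).mono ?_
      fun _ h => h⟩
    · simp [NatExpr.eval, RealExpr.eval, Store.nat_setNat, Store.real_setNat, Store.nat_setReal,
        Store.real_setReal, hi, hr, h9, h11, r0, r1, Finset.sum_range_succ]
      exact hb
    · simp [NatExpr.cost, RealExpr.cost]
  · rintro i s' hk - ⟨hi, hle, hr⟩ hb
    simp only [Test.Holds, NatExpr.eval, hi, hk.nat 0 (by decide)] at hb
    simp [Store.nat_setNat, Store.nat_setReal] at hb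
    rw [hr, show i = s.nat 0 2 by omega]
  · simp only [Test.cost, NatExpr.cost, RealExpr.cost]
    omega

/-- Computes in variable `13` the digit of type `12` of the updated belief vector, and appends it to
the code in variable `15`. -/
def digitProg : Program :=
  .seq (set 13 (.const 0))
    (.loop (.neg (.realLt (.mul (.cast (var 5)) (.div
        (.mul (.get 1 (.add (var 9) (var 12))) (.get 0 (.add (var 11) (var 12)))) (.var 4)))
        (.cast (.add (var 13) (.const 1)))))
      (.seq (inc 13 (.const 1)) (set 15 (.add (.add (var 15) (var 15)) (.const 1)))))

/-- The floor is found by counting, so its cost is proportional to the digit. Each round replaces c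
by 2c + 1 and so appends a binary 1 to the code; the closing 0 is the later doubling in `roundProg`.
-/
theorem digitProg_spec {s : Store} {x : ℝ} (hx : x = s.nat 5 0 *
      (s.real 1 (s.nat 9 0 + s.nat 12 0) * s.real 0 (s.nat 11 0 + s.nat 12 0) / s.real 4 0))
    (hx0 : 0 ≤ x) :
    Ends digitProg s (⌊x⌋₊ * 50 + 50) fun s' => s'.nat 13 0 = ⌊x⌋₊ ∧
      s'.nat 15 0 = (s.nat 15 0 + 1) * 2 ^ ⌊x⌋₊ - 1 := by
  refine (Ends.seq_nat (Ends.loop (fun i s' => s'.nat 13 0 = i ∧ i ≤ ⌊x⌋₊ ∧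
    s'.nat 15 0 = (s.nat 15 0 + 1) * 2 ^ i - 1) ⌊x⌋₊ 20 ?_ ?_ ?_)).mono ?_ fun _ h => h
  · simp [NatExpr.eval, Store.nat_setNat]
  · rintro i s' hk ⟨hi, -, hc⟩ hb
    have h5 := hk.nat 5 (by decide)
    have h9 := hk.nat 9 (by decide)
    have h11 := hk.nat 11 (by decide)
    have h12 := hk.nat 12 (by decide)
    have r0 := hk.real 0 (by decide)
    have r1 := hk.real 1 (by decide)
    have r4 := hk.real 4 (by decide)
    simp only [Test.Holds, NatExpr.eval, RealExpr.eval, hi, h5, h9, h11, h12, r0, r1, r4] at hb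
    simp [Store.nat_setNat, Store.real_setNat] at hb
    rw [← hx] at hb
    have hlt : i < ⌊x⌋₊ := Nat.le_floor (by push_cast; exact hb)
    refine ⟨hlt, (Ends.seq_nat (Ends.assignNat (T := 10) ?_ (by simp [NatExpr.cost]))).mono ?_
      fun _ h => h⟩
    · simp [NatExpr.eval, Store.nat_setNat, hi, hc]
      refine ⟨hlt, ?_⟩
      have : 0 < (s.nat 15 0 + 1) * 2 ^ i := by positivity
      rw [pow_succ, ← mul_assoc]
      omega
    · simp [NatExpr.cost]
  · rintro i s' hk - ⟨hi, hle, hc⟩ hb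
    have h5 := hk.nat 5 (by decide)
    have h9 := hk.nat 9 (by decide)
    have h11 := hk.nat 11 (by decide)
    have h12 := hk.nat 12 (by decide)
    have r0 := hk.real 0 (by decide)
    have r1 := hk.real 1 (by decide)
    have r4 := hk.real 4 (by decide)
    simp only [Test.Holds, NatExpr.eval, RealExpr.eval, hi, h5, h9, h11, h12, r0, r1, r4] at hb
    simp [Store.nat_setNat, Store.real_setNat] at hb
    rw [← hx] at hb
    have : i = ⌊x⌋₊ := by
      refine le_antisymm hle (Nat.lt_succ_iff.1 ((Nat.floor_lt hx0).2 ?_))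
      push_cast
      exact hb
    rw [← this]
    exact ⟨hi, hc⟩
  · simp only [Test.cost, NatExpr.cost, RealExpr.cost]
    omega

end RealRAM

/-! ### Rounding an updated belief on the machine. -/

namespace RealRAM
open NatExpr Program GridRounding

/-- Writes the rounding of the updated belief vector to address `7`, and its code to
variable `15`. -/
def roundProg : Program :=
  .seq (set 12 (.const 0)) (.seq (set 14 (.const 0)) (.seq (set 15 (.const 0)) (.seq
    (.loop (.natLt (.add (var 12) (.const 1)) types)
      (.seq digitProg
        (.seq (.assignReal 1 (.add (var 7) (var 12)) (.div (.cast (var 13)) (.cast (var 5))))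
          (.seq (set 15 (.add (var 15) (var 15))) (.seq (inc 14 (var 13)) (inc 12 (.const 1)))))))
    (.assignReal 1 (.add (var 7) (var 12))
      (.div (.cast (.sub (.sub (var 5) (var 14)) (.sub types (.const 1)))) (.cast (var 5)))))))

/-- The cost contains the sum of the digits, not d times their maximum. The new vector is written
from address `7` on, above the stored beliefs by `h97`, so `Z` stays intact while it is being read.
-/
theorem roundProg_spec {s : Store} {d : ℕ} (hd : s.nat 0 2 = d + 1) {Z : ℕ → ℝ}
    (hZ : ∀ m, Z m = s.real 1 (s.nat 9 0 + m) * s.real 0 (s.nat 11 0 + m))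
    (hZ0 : ∀ m < d + 1, 0 ≤ Z m) (hr : 0 ≤ s.real 4 0) (h97 : s.nat 9 0 + (d + 1) ≤ s.nat 7 0) :
    Ends roundProg s
      (d * 200 + (∑ m ∈ Finset.range d, digits (s.nat 5 0) (s.real 4 0) Z m) * 50 + 100) fun s' =>
      s'.nat 15 0 = code (digits (s.nat 5 0) (s.real 4 0) Z) d ∧
      (∀ m < d + 1, s'.real 1 (s.nat 7 0 + m)
        = gridVec (s.nat 5 0) d (digits (s.nat 5 0) (s.real 4 0) Z) m) ∧
      ∀ l < s.nat 7 0, s'.real 1 l = s.real 1 l := by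
  set a := digits (s.nat 5 0) (s.real 4 0) Z with ha
  refine (Ends.seq_nat (Ends.seq_nat (Ends.seq_nat (Ends.seq_keeps (T' := 40) (Ends.loop_sum
    (fun i s' => s'.nat 12 0 = i ∧ i ≤ d ∧ s'.nat 14 0 = ∑ m ∈ Finset.range i, a m ∧
      s'.nat 15 0 = code a i ∧ (∀ m < i, s'.real 1 (s.nat 7 0 + m) = gridVec (s.nat 5 0) d a m) ∧
      ∀ l < s.nat 7 0, s'.real 1 l = s.real 1 l)
    d (fun m => a m * 50 + 120)
    (Q := fun s' => s'.nat 12 0 = d ∧ s'.nat 14 0 = ∑ m ∈ Finset.range d, a m ∧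
      s'.nat 15 0 = code a d ∧ (∀ m < d, s'.real 1 (s.nat 7 0 + m) = gridVec (s.nat 5 0) d a m) ∧
      ∀ l < s.nat 7 0, s'.real 1 l = s.real 1 l)
    ?_ ?_ ?_) ?_)))).mono ?_ fun _ h => h
  · simp [NatExpr.eval, Store.nat_setNat, Store.real_setNat, code]
  · rintro i s' hk ⟨hi, -, hsum, hc, hv, hl⟩ hb
    have h0 := hk.nat 0 (by decide)
    have h5 := hk.nat 5 (by decide)
    have h7 := hk.nat 7 (by decide)
    have h9 := hk.nat 9 (by decide)
    have h11 := hk.nat 11 (by decide)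
    have r0 := hk.real 0 (by decide)
    have r4 := hk.real 4 (by decide)
    replace h0 : s'.nat 0 2 = d + 1 := by rw [h0]; simpa [Store.nat_setNat] using hd
    replace h5 : s'.nat 5 0 = s.nat 5 0 := by rw [h5]; simp [Store.nat_setNat]
    replace h7 : s'.nat 7 0 = s.nat 7 0 := by rw [h7]; simp [Store.nat_setNat]
    replace h9 : s'.nat 9 0 = s.nat 9 0 := by rw [h9]; simp [Store.nat_setNat]
    replace h11 : s'.nat 11 0 = s.nat 11 0 := by rw [h11]; simp [Store.nat_setNat]
    simp only [Store.real_setNat] at r0 r4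
    simp only [Test.Holds, NatExpr.eval, hi, h0] at hb
    have hid : i < d := by omega
    have hx : (s.nat 5 0 : ℝ) * (Z i / s.real 4 0) = s'.nat 5 0 *
        (s'.real 1 (s'.nat 9 0 + s'.nat 12 0) * s'.real 0 (s'.nat 11 0 + s'.nat 12 0)
          / s'.real 4 0) := by
      rw [h5, h9, hi, h11, r0, r4, hl _ (by omega), hZ]
    have hx0 : 0 ≤ (s.nat 5 0 : ℝ) * (Z i / s.real 4 0) :=
      mul_nonneg (Nat.cast_nonneg _) (div_nonneg (hZ0 i (by omega)) hr)
    refine ⟨hid, ((digitProg_spec hx hx0).seq_keeps (T' := 60) ?_).mono ?_ fun _ h => h⟩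
    · rintro s'' hk' ⟨h13, h15⟩
      have h5' := hk'.nat 5 (by decide)
      have h7' := hk'.nat 7 (by decide)
      have h12' := hk'.nat 12 (by decide)
      have h14' := hk'.nat 14 (by decide)
      have r1' := hk'.real 1 (by decide)
      change s''.nat 13 0 = a i at h13
      change s''.nat 15 0 = (s'.nat 15 0 + 1) * 2 ^ a i - 1 at h15
      refine (Ends.seq_real (Ends.seq_nat (Ends.seq_nat (Ends.assignNat (T := 6) ?_
        (by simp [NatExpr.cost]))))).mono (by simp [NatExpr.cost, RealExpr.cost]) fun _ h => h
      simp only [NatExpr.eval, RealExpr.eval, Store.nat_setNat, Store.real_setNat,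
        Store.nat_setReal, Store.real_setReal, h5', h7', h12', h14', r1', h13, h15, hi, h5, h7,
        hsum, hc, and_self, if_true]
      norm_num
      refine ⟨by omega, by rw [Finset.sum_range_succ], ?_, ?_, ?_⟩
      · rw [code]; omega
      · intro m hm
        by_cases hmi : m = i
        · simp [hmi, gridVec, hid]
        · rw [if_neg hmi]
          exact hv m (by omega)
      · intro l hl'
        rw [if_neg (by omega)]
        exact hl l hl'
    · change a i * 50 + 50 + 60 ≤ _
      omega
  · rintro i s' hk - ⟨hi, hle, hsum, hc, hv, hl⟩ hb
    have h0 := hk.nat 0 (by decide)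
    replace h0 : s'.nat 0 2 = d + 1 := by rw [h0]; simpa [Store.nat_setNat] using hd
    simp only [Test.Holds, NatExpr.eval, hi, h0] at hb
    obtain rfl : i = d := by omega
    exact ⟨hi, hsum, hc, hv, hl⟩
  · rintro s' hk ⟨hi, hsum, hc, hv, hl⟩
    have h0 := hk.nat 0 (by decide)
    have h5 := hk.nat 5 (by decide)
    have h7 := hk.nat 7 (by decide)
    replace h0 : s'.nat 0 2 = d + 1 := by rw [h0]; simpa [Store.nat_setNat] using hd
    replace h5 : s'.nat 5 0 = s.nat 5 0 := by rw [h5]; simp [Store.nat_setNat]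
    replace h7 : s'.nat 7 0 = s.nat 7 0 := by rw [h7]; simp [Store.nat_setNat]
    refine Ends.assignReal ?_ (by simp [NatExpr.cost, RealExpr.cost])
    simp only [NatExpr.eval, RealExpr.eval, Store.nat_setReal, Store.real_setReal, h0, h5, h7, hi,
      hsum, true_and]
    refine ⟨hc, fun m hm => ?_, fun l hl' => ?_⟩
    · by_cases hmi : m = d
      · simp [hmi, gridVec]
      · rw [if_neg (by omega)]
        exact hv m (by omega)
    · rw [if_neg (by omega)]
      exact hl l hl'
  · simp only [Test.cost, NatExpr.cost, Finset.sum_add_distrib, Finset.sum_const,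
      Finset.card_range, smul_eq_mul, ← Finset.sum_mul]
    omega

end RealRAM

/-! ### The graph of reachable rounded beliefs. -/

namespace BeliefGraph
open GridRounding ApproxDP

/-- The list of the belief vectors found so far: number `j` is stored from `B (j * (d + 1))` on;
number `0` is the prior, and the others are points of the grid. `V c` is the number of the grid
point with code `c`, or `0` if that has not been found. -/
structure Nodes (n d : ℕ) (q : ℕ → ℝ) (cnt : ℕ) (V : ℕ → ℕ) (B : ℕ → ℝ) : Prop where
  pos : 1 ≤ cnt
  prior : ∀ m < d + 1, B m = q m
  found : ∀ c, V c ≠ 0 → V c < cnt ∧ ∃ a : ℕ → ℕ, c = code a d ∧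
    ∑ i ∈ Finset.range d, a i ≤ n ∧ ∀ m < d + 1, B (V c * (d + 1) + m) = gridVec n d a m
  onto : ∀ i, i ≠ 0 → i < cnt → ∃ c, V c = i

variable {n d : ℕ} {q : ℕ → ℝ} {cnt : ℕ} {V : ℕ → ℕ} {B : ℕ → ℝ}

theorem cell_lt {j cnt d m : ℕ} (hj : j < cnt) (hm : m < d + 1) :
    j * (d + 1) + m < cnt * (d + 1) := by
  have := Nat.mul_le_mul_right (d + 1) (Nat.succ_le_of_lt hj)
  rw [Nat.succ_mul] at this
  omega

theorem Nodes.start (n d : ℕ) (q : ℕ → ℝ) : Nodes n d q 1 (fun _ => 0) q where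
  pos := le_rfl
  prior _ _ := rfl
  found c h := absurd rfl h
  onto i h0 h1 := absurd h1 (by omega)

/-- Scratch vectors are written behind the list, so they do not disturb it. -/
theorem Nodes.congr (N : Nodes n d q cnt V B) {B' : ℕ → ℝ}
    (h : ∀ l < cnt * (d + 1), B' l = B l) : Nodes n d q cnt V B' where
  pos := N.pos
  prior m hm := by
    have := cell_lt N.pos hm
    rw [h m (by omega), N.prior m hm]
  found c hc := by
    obtain ⟨hlt, a, h1, h2, h3⟩ := N.found c hc
    exact ⟨hlt, a, h1, h2, fun m hm => by rw [h _ (cell_lt hlt hm), h3 m hm]⟩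
  onto := N.onto

theorem Nodes.lookup (N : Nodes n d q cnt V B) {a : ℕ → ℕ} (h : V (code a d) ≠ 0) :
    V (code a d) < cnt ∧ ∀ m < d + 1, B (V (code a d) * (d + 1) + m) = gridVec n d a m := by
  obtain ⟨hlt, b, h1, -, h3⟩ := N.found _ h
  rw [gridVec_congr (code_inj h1)]
  exact ⟨hlt, h3⟩

/-- The value 0 can mean "absent", since number 0 is the prior and is never entered under a code.
Should the prior be a grid point, it is merely stored twice. -/
theorem Nodes.insert (N : Nodes n d q cnt V B) {a : ℕ → ℕ}
    (ha : ∑ i ∈ Finset.range d, a i ≤ n) (hV : V (code a d) = 0)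
    (hB : ∀ m < d + 1, B (cnt * (d + 1) + m) = gridVec n d a m) :
    Nodes n d q (cnt + 1) (fun c => if c = code a d then cnt else V c) B where
  pos := by omega
  prior := N.prior
  found c hc := by
    by_cases h : c = code a d
    · simp only [if_pos h]
      exact ⟨by omega, a, h, ha, hB⟩
    · simp only [if_neg h] at hc ⊢
      obtain ⟨hlt, hex⟩ := N.found c hc
      exact ⟨by omega, hex⟩
  onto i h0 hi := by
    rcases Nat.lt_succ_iff_lt_or_eq.1 hi with hlt | rfl
    · obtain ⟨c, hc⟩ := N.onto i h0 hlt
      refine ⟨c, ?_⟩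
      rw [if_neg, hc]
      rintro rfl
      exact h0 (hc.symm.trans hV)
    · exact ⟨_, if_pos rfl⟩

theorem Nodes.exists_digits (N : Nodes n d q cnt V B) {i : ℕ} (h0 : i ≠ 0) (hi : i < cnt) :
    ∃ a : ℕ → ℕ, V (code a d) = i ∧ ∑ i ∈ Finset.range d, a i ≤ n ∧
      ∀ m < d + 1, B (i * (d + 1) + m) = gridVec n d a m := by
  obtain ⟨c, rfl⟩ := N.onto i h0 hi
  obtain ⟨-, a, h1, h2, h3⟩ := N.found c h0
  exact ⟨a, by rw [h1], h2, h3⟩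

theorem Nodes.nonneg (N : Nodes n d q cnt V B) (hq : ∀ m < d + 1, 0 ≤ q m) {j : ℕ} (hj : j < cnt)
    {m : ℕ} (hm : m < d + 1) : 0 ≤ B (j * (d + 1) + m) := by
  by_cases h0 : j = 0
  · rw [h0, zero_mul, zero_add, N.prior m hm]
    exact hq m hm
  · obtain ⟨a, -, -, h⟩ := N.exists_digits h0 hj
    rw [h m hm]
    exact gridVec_nonneg n d a m

theorem Nodes.sum_le (N : Nodes n d q cnt V B) (hq : ∑ m ∈ Finset.range (d + 1), q m ≤ 1) {j : ℕ}
    (hj : j < cnt) : ∑ m ∈ Finset.range (d + 1), B (j * (d + 1) + m) ≤ 1 := by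
  by_cases h0 : j = 0
  · rw [h0]
    refine le_trans (le_of_eq (Finset.sum_congr rfl fun m hm => ?_)) hq
    rw [zero_mul, zero_add, N.prior m (Finset.mem_range.1 hm)]
  · obtain ⟨a, -, ha, h⟩ := N.exists_digits h0 hj
    rw [Finset.sum_congr rfl fun m hm => h m (Finset.mem_range.1 hm)]
    exact sum_gridVec_le_one ha

/-- Belief number i ≠ 0 is recovered from its digits as `V (code a d)`, so distinct numbers have
distinct digit tuples; the summand 1 is the prior. -/
theorem Nodes.card_le (N : Nodes n d q cnt V B) {x : ℝ} (hx : 0 < x) :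
    (cnt : ℝ) ≤ 1 + ((x + 1) / x) ^ n * (x + 1) ^ d := by
  classical
  have hex : ∀ i : Fin (cnt - 1), ∃ a : ℕ → ℕ, V (code a d) = i + 1 ∧
      ∑ i ∈ Finset.range d, a i ≤ n := fun i => by
    obtain ⟨a, h1, h2, -⟩ := N.exists_digits (Nat.succ_ne_zero i) (show (i : ℕ) + 1 < cnt by omega)
    exact ⟨a, h1, h2⟩
  choose a ha1 ha2 using hex
  let f : Fin (cnt - 1) → Fin d → ℕ := fun i m => a i m
  have hinj : Function.Injective f := by
    intro i i' h
    have : code (a i) d = code (a i') d := code_congr fun m hm => congrFun h ⟨m, hm⟩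
    have h1 := ha1 i
    rw [this, ha1 i'] at h1
    exact Fin.ext (by omega)
  have := card_le_of_sum_le (n := n) hx (Finset.univ.image f) ?_
  · rw [Finset.card_image_of_injective _ hinj, Finset.card_univ, Fintype.card_fin,
      Nat.cast_sub N.pos] at this
    push_cast at this
    linarith
  · intro b hb
    obtain ⟨i, -, rfl⟩ := Finset.mem_image.1 hb
    have := ha2 i
    rwa [Finset.sum_range] at this

/-- The first `L` edges, of which number `j * K + k` belongs to belief vector `j` and
recommendation `k`, have been computed. -/
def Edges (n d K : ℕ) (P : ℕ → ℕ → ℝ) (cnt L : ℕ) (B : ℕ → ℝ) (E : ℕ → ℕ) (R : ℕ → ℝ) : Prop :=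
  ∀ j k, k < K → j * K + k < L → j < cnt ∧ E (j * K + k) < cnt ∧
    R (j * K + k) = ∑ m ∈ Finset.range (d + 1), B (j * (d + 1) + m) * P k m ∧
    (∀ m < d + 1, R (j * K + k) * B (E (j * K + k) * (d + 1) + m)
      ≤ B (j * (d + 1) + m) * P k m) ∧
    R (j * K + k) - R (j * K + k) * ∑ m ∈ Finset.range (d + 1), B (E (j * K + k) * (d + 1) + m)
      ≤ R (j * K + k) * ((d : ℝ) / n)

variable {K : ℕ} {P : ℕ → ℕ → ℝ} {L : ℕ} {E : ℕ → ℕ} {R : ℕ → ℝ}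

theorem Edges.start (n d K : ℕ) (P : ℕ → ℕ → ℝ) (cnt : ℕ) (B : ℕ → ℝ) (E : ℕ → ℕ) (R : ℕ → ℝ) :
    Edges n d K P cnt 0 B E R := fun _ _ _ h => absurd h (Nat.not_lt_zero _)

theorem edge_inj {j k j' k' K : ℕ} (hk : k < K) (hk' : k' < K) (h : j * K + k = j' * K + k') :
    j = j' ∧ k = k' := by
  have hK : 0 < K := by omega
  have h1 := congrArg (· / K) h
  have h2 := congrArg (· % K) h
  simp only [mul_comm _ K, Nat.mul_add_div hK, Nat.div_eq_of_lt hk, Nat.div_eq_of_lt hk',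
    Nat.mul_add_mod, Nat.mod_eq_of_lt hk, Nat.mod_eq_of_lt hk', add_zero] at h1 h2
  exact ⟨h1, h2⟩

/-- Old edges only refer to beliefs with numbers below `cnt`, whose cells are unchanged; only edge
`L` needs an argument. -/
theorem Edges.step (hE : Edges n d K P cnt L B E R) {cnt' : ℕ} {B' : ℕ → ℝ} {E' : ℕ → ℕ}
    {R' : ℕ → ℝ} {j k : ℕ} (hk : k < K) (hL : L = j * K + k) (hj : j < cnt) (hcnt : cnt ≤ cnt')
    (hB : ∀ l < cnt * (d + 1), B' l = B l) (hE' : ∀ l < L, E' l = E l)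
    (hR' : ∀ l < L, R' l = R l) (hlt : E' L < cnt')
    (hr : R' L = ∑ m ∈ Finset.range (d + 1), B (j * (d + 1) + m) * P k m)
    (hle : ∀ m < d + 1, R' L * B' (E' L * (d + 1) + m) ≤ B (j * (d + 1) + m) * P k m)
    (hloss : R' L - R' L * ∑ m ∈ Finset.range (d + 1), B' (E' L * (d + 1) + m)
      ≤ R' L * ((d : ℝ) / n)) :
    Edges n d K P cnt' (L + 1) B' E' R' := by
  intro i l hl hi
  rcases Nat.lt_succ_iff_lt_or_eq.1 hi with hi | hi
  · obtain ⟨h1, h2, h3, h4, h5⟩ := hE i l hl hi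
    have hBi : ∀ m ∈ Finset.range (d + 1), B' (i * (d + 1) + m) = B (i * (d + 1) + m) :=
      fun m hm => hB _ (cell_lt h1 (Finset.mem_range.1 hm))
    have hBE : ∀ m ∈ Finset.range (d + 1),
        B' (E (i * K + l) * (d + 1) + m) = B (E (i * K + l) * (d + 1) + m) :=
      fun m hm => hB _ (cell_lt h2 (Finset.mem_range.1 hm))
    rw [hE' _ hi, hR' _ hi, Finset.sum_congr rfl hBE]
    refine ⟨by omega, by omega, h3.trans (Finset.sum_congr rfl fun m hm => by rw [hBi m hm]),
      fun m hm => ?_, h5⟩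
    rw [hBE m (Finset.mem_range.2 hm), hBi m (Finset.mem_range.2 hm)]
    exact h4 m hm
  · obtain ⟨rfl, rfl⟩ := edge_inj hl hk (hi.trans hL)
    have hBi : ∀ m ∈ Finset.range (d + 1), B' (i * (d + 1) + m) = B (i * (d + 1) + m) :=
      fun m hm => hB _ (cell_lt hj (Finset.mem_range.1 hm))
    rw [hi]
    refine ⟨by omega, hlt, hr.trans (Finset.sum_congr rfl fun m hm => by rw [hBi m hm]),
      fun m hm => ?_, hloss⟩
    rw [hBi m (Finset.mem_range.2 hm)]
    exact hle m hm

theorem edge_lt {j k cnt K : ℕ} (hj : j < cnt) (hk : k < K) : j * K + k < cnt * K := by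
  have := Nat.mul_le_mul_right K (Nat.succ_le_of_lt hj)
  rw [Nat.succ_mul] at this
  omega

theorem Edges.table (N : Nodes n d q cnt V B) (hE : Edges n d K P cnt (cnt * K) B E R)
    (hq0 : ∀ m < d + 1, 0 ≤ q m) (hq1 : ∑ m ∈ Finset.range (d + 1), q m ≤ 1) :
    Table (d + 1) K cnt P (fun j m => B (j * (d + 1) + m)) (fun j k => E (j * K + k))
      (fun j k => R (j * K + k)) ((d : ℝ) / n) where
  next_lt j hj k hk := (hE j k hk (edge_lt hj hk)).2.1
  prob j hj k hk := (hE j k hk (edge_lt hj hk)).2.2.1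
  le j hj k hk := (hE j k hk (edge_lt hj hk)).2.2.2.1
  loss j hj k hk := (hE j k hk (edge_lt hj hk)).2.2.2.2
  nonneg _ hj _ hm := N.nonneg hq0 hj hm
  sum_le _ hj := N.sum_le hq1 hj

end BeliefGraph

/-! ### Programs that explore the belief graph. -/

namespace RealRAM
open NatExpr Program GridRounding BeliefGraph

/-- Enters the new belief vector into the list, unless it is there already. -/
def insertProg : Program :=
  .cond (.natLt (.get 16 (var 15)) (.const 1))
    (.seq (.assignNat 16 (var 15) (var 6)) (.seq (inc 6 (.const 1)) (inc 7 types))) .skip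

theorem insertProg_spec {s : Store} {n d : ℕ} {q : ℕ → ℝ} (hd : s.nat 0 2 = d + 1)
    (hN : Nodes n d q (s.nat 6 0) (s.nat 16) (s.real 1)) (h7 : s.nat 7 0 = s.nat 6 0 * (d + 1))
    {a : ℕ → ℕ} (ha : ∑ i ∈ Finset.range d, a i ≤ n) (hc : s.nat 15 0 = code a d)
    (hB : ∀ m < d + 1, s.real 1 (s.nat 7 0 + m) = gridVec n d a m) :
    Ends insertProg s 40 fun s' => Nodes n d q (s'.nat 6 0) (s'.nat 16) (s'.real 1) ∧
      s'.nat 7 0 = s'.nat 6 0 * (d + 1) ∧ s.nat 6 0 ≤ s'.nat 6 0 ∧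
      s'.nat 16 (code a d) < s'.nat 6 0 ∧
      ∀ m < d + 1, s'.real 1 (s'.nat 16 (code a d) * (d + 1) + m) = gridVec n d a m := by
  rw [h7] at hB
  refine (Ends.cond (T := 35) ?_ ?_).mono ?_ fun _ h => h
  · intro hb
    simp only [Test.Holds, NatExpr.eval, hc, Nat.lt_one_iff] at hb
    have hN' := hN.insert ha hb hB
    have h16 : (fun c => if c = code a d then s.nat 6 0 else s.nat 16 c) =
        (s.setNat 16 (code a d) (s.nat 6 0)).nat 16 := by
      funext c
      simp [Store.nat_setNat]
    rw [h16] at hN'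
    refine (Ends.seq_nat (Ends.seq_nat (Ends.assignNat (T := 10) ?_ (by simp [NatExpr.cost])))).mono
      (by simp [NatExpr.cost]) fun _ h => h
    refine ⟨?_, ?_, ?_, ?_, ?_⟩
    · simpa [Store.nat_setNat_of_ne, Store.nat_setNat, Store.real_setNat, NatExpr.eval, hc]
        using hN'
    · simp [Store.nat_setNat, NatExpr.eval, hd, h7]
      ring
    · simp [Store.nat_setNat, NatExpr.eval]
    · simp [Store.nat_setNat, NatExpr.eval, hc]
    · intro m hm
      simpa [Store.nat_setNat, NatExpr.eval, hc, Store.real_setNat] using hB m hm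
  · intro hb
    simp only [Test.Holds, NatExpr.eval, hc, Nat.lt_one_iff] at hb
    exact Ends.skip ⟨hN, h7, le_rfl, hN.lookup hb⟩ (by norm_num)
  · simp [Test.cost, NatExpr.cost]

/-- Computes the next edge. -/
def edgeProg : Program :=
  .seq probProg (.seq roundProg (.seq insertProg
    (.seq (.assignNat 17 (var 18) (.get 16 (var 15))) (.seq (.assignReal 5 (var 18) (.var 4))
      (.seq (inc 18 (.const 1)) (.seq (inc 10 (.const 1)) (inc 11 types)))))))

/-- What is known when the first `k` edges of belief vector `j` have been computed. -/
structure Exploring (n d K : ℕ) (q : ℕ → ℝ) (P : ℕ → ℕ → ℝ) (j k : ℕ) (s : Store) : Prop where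
  nodes : Nodes n d q (s.nat 6 0) (s.nat 16) (s.real 1)
  ptr : s.nat 7 0 = s.nat 6 0 * (d + 1)
  row : s.nat 9 0 = j * (d + 1)
  index : s.nat 8 0 = j
  edge : s.nat 18 0 = j * K + k
  edges : Edges n d K P (s.nat 6 0) (j * K + k) (s.real 1) (s.nat 17) (s.real 5)

/-- The digits add up to at most n by `sum_digits_le`, so n enters the cost once and not once per
type. The two rounding estimates for the grid vector become the fields `le` and `loss` of the table.
-/
theorem edgeProg_spec {s : Store} {n d K j k : ℕ} {q : ℕ → ℝ} {P : ℕ → ℕ → ℝ}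
    (hX : Exploring n d K q P j k s) (hd : s.nat 0 2 = d + 1) (hn : s.nat 5 0 = n) (hn0 : 0 < n)
    (hP : ∀ k m, P k m = s.real 0 (k * (d + 1) + m)) (hP0 : ∀ k < K, ∀ m < d + 1, 0 ≤ P k m)
    (hq0 : ∀ m < d + 1, 0 ≤ q m) (hj : j < s.nat 6 0) (hk : k < K) (h10 : s.nat 10 0 = k)
    (h11 : s.nat 11 0 = k * (d + 1)) :
    Ends edgeProg s (d * 300 + n * 50 + 400) fun s' =>
      Exploring n d K q P j (k + 1) s' ∧ s'.nat 10 0 = k + 1 ∧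
        s'.nat 11 0 = (k + 1) * (d + 1) ∧ s.nat 6 0 ≤ s'.nat 6 0 := by
  obtain ⟨hN, hptr, hrow, hidx, hedge, hE⟩ := hX
  set Z : ℕ → ℝ := fun m => s.real 1 (j * (d + 1) + m) * P k m with hZ
  set r : ℝ := ∑ m ∈ Finset.range (d + 1), Z m with hr
  have hZ0 : ∀ m < d + 1, 0 ≤ Z m := fun m hm => mul_nonneg (hN.nonneg hq0 hj hm) (hP0 k hk m hm)
  have hr0 : 0 ≤ r := Finset.sum_nonneg fun m hm => hZ0 m (Finset.mem_range.1 hm)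
  set a := digits n r Z with ha
  have hsum : ∑ i ∈ Finset.range d, a i ≤ n := sum_digits_le hZ0 hr
  refine (probProg_spec.seq_keeps (T' := d * 200 + n * 50 + 300) ?_).mono ?_ fun _ h => h
  swap
  · rw [hd]; ring_nf; omega
  intro s1 hk1 h1
  replace h1 : s1.real 4 0 = r := by
    rw [h1, hd, hr]
    exact Finset.sum_congr rfl fun m _ => by simp only [hZ]; rw [hP, hrow, h11]
  have a0 := congrFun (hk1.nat 0 (by decide)) 2
  have a5 := congrFun (hk1.nat 5 (by decide)) 0
  have a6 := congrFun (hk1.nat 6 (by decide)) 0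
  have a7 := congrFun (hk1.nat 7 (by decide)) 0
  have a8 := congrFun (hk1.nat 8 (by decide)) 0
  have a9 := congrFun (hk1.nat 9 (by decide)) 0
  have a10 := congrFun (hk1.nat 10 (by decide)) 0
  have a11 := congrFun (hk1.nat 11 (by decide)) 0
  have a16 := hk1.nat 16 (by decide)
  have a17 := hk1.nat 17 (by decide)
  have a18 := congrFun (hk1.nat 18 (by decide)) 0
  have r0 := hk1.real 0 (by decide)
  have r1 := hk1.real 1 (by decide)
  have r5 := hk1.real 5 (by decide)
  rw [hd] at a0; rw [hn] at a5; rw [hptr] at a7; rw [hidx] at a8; rw [hrow] at a9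
  rw [h10] at a10; rw [h11] at a11; rw [hedge] at a18
  have hround := roundProg_spec (s := s1) (d := d) (Z := Z) a0
    (fun m => by simp only [hZ]; rw [hP, a9, a11, r0, r1]) hZ0 (by rw [h1]; exact hr0) (by
      rw [a9, a7]
      have := cell_lt hj d.lt_succ_self
      omega)
  rw [a5, h1, ← ha, a7] at hround
  refine (hround.seq_keeps (T' := 120) ?_).mono (by omega) fun _ h => h
  rintro s2 hk2 ⟨h2c, h2v, h2l⟩
  have b0 := congrFun (hk2.nat 0 (by decide)) 2
  have b6 := congrFun (hk2.nat 6 (by decide)) 0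
  have b7 := congrFun (hk2.nat 7 (by decide)) 0
  have b8 := congrFun (hk2.nat 8 (by decide)) 0
  have b9 := congrFun (hk2.nat 9 (by decide)) 0
  have b10 := congrFun (hk2.nat 10 (by decide)) 0
  have b11 := congrFun (hk2.nat 11 (by decide)) 0
  have b16 := hk2.nat 16 (by decide)
  have b17 := hk2.nat 17 (by decide)
  have b18 := congrFun (hk2.nat 18 (by decide)) 0
  have t4 := congrFun (hk2.real 4 (by decide)) 0
  have t5 := hk2.real 5 (by decide)
  rw [a0] at b0; rw [a6] at b6; rw [a7] at b7; rw [a8] at b8; rw [a9] at b9; rw [a10] at b10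
  rw [a11] at b11; rw [a16] at b16; rw [a17] at b17; rw [a18] at b18; rw [h1] at t4
  rw [r5] at t5
  rw [r1] at h2l
  have hN2 : Nodes n d q (s2.nat 6 0) (s2.nat 16) (s2.real 1) := by
    rw [b6, b16]
    exact hN.congr h2l
  refine ((insertProg_spec b0 hN2 (by rw [b7, b6]) hsum h2c (by rwa [b7])).seq_keeps
    (T' := 80) ?_).mono (by omega) fun _ h => h
  rintro s3 hk3 ⟨h3N, h3p, h3c, h3lt, h3v⟩
  have c0 := congrFun (hk3.nat 0 (by decide)) 2
  have c8 := congrFun (hk3.nat 8 (by decide)) 0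
  have c9 := congrFun (hk3.nat 9 (by decide)) 0
  have c10 := congrFun (hk3.nat 10 (by decide)) 0
  have c11 := congrFun (hk3.nat 11 (by decide)) 0
  have c15 := congrFun (hk3.nat 15 (by decide)) 0
  have c17 := hk3.nat 17 (by decide)
  have c18 := congrFun (hk3.nat 18 (by decide)) 0
  have u1 := hk3.real 1 (by decide)
  have u4 := congrFun (hk3.real 4 (by decide)) 0
  have u5 := hk3.real 5 (by decide)
  rw [b0] at c0; rw [b8] at c8; rw [b9] at c9; rw [b10] at c10; rw [b11] at c11
  rw [h2c] at c15; rw [b17] at c17; rw [b18] at c18; rw [t4] at u4; rw [t5] at u5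
  rw [b6] at h3c
  have hgv : ∀ m ∈ Finset.range (d + 1),
      s3.real 1 (s3.nat 16 (code a d) * (d + 1) + m) = gridVec n d a m :=
    fun m hm => h3v m (Finset.mem_range.1 hm)
  refine (Ends.seq_nat (Ends.seq_real (Ends.seq_nat (Ends.seq_nat (Ends.assignNat (T := 7)
    ?_ (by simp [NatExpr.cost])))))).mono ?_ fun _ h => h
  · refine ⟨⟨?_, ?_, ?_, ?_, ?_, ?_⟩, ?_, ?_, ?_⟩
    · simpa [Store.nat_setNat_of_ne, Store.real_setReal_of_ne, Store.real_setNat,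
        Store.nat_setReal] using h3N
    · simpa [Store.nat_setNat, Store.nat_setReal] using h3p
    · simpa [Store.nat_setNat, Store.nat_setReal] using c9
    · simpa [Store.nat_setNat, Store.nat_setReal] using c8
    · simp [Store.nat_setNat, Store.nat_setReal, NatExpr.eval, c18]
      ring
    · refine hE.step hk rfl hj ?_ ?_ ?_ ?_ ?_ ?_ ?_ ?_
      · simpa [Store.nat_setNat, Store.nat_setReal] using h3c
      · intro l hl
        simp [Store.real_setNat, Store.real_setReal, u1, h2l l hl]
      · intro l hl
        simp [Store.nat_setNat, Store.nat_setReal, NatExpr.eval, c18, c17, hl.ne]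
      · intro l hl
        simp [Store.nat_setNat, Store.real_setNat, Store.real_setReal, NatExpr.eval, c18, u5, hl.ne]
      all_goals simp only [NatExpr.eval, RealExpr.eval, Store.nat_setNat, Store.nat_setReal,
        Store.real_setNat, Store.real_setReal, c15, c18, u4]
      all_goals norm_num
      · exact h3lt
      · rfl
      · intro m hm
        rw [h3v m (Nat.lt_succ_of_le hm)]
        exact mul_gridVec_digits_le hn0 hZ0 hr (Nat.lt_succ_of_le hm)
      · rw [Finset.sum_congr rfl hgv]
        have := sub_mul_sum_gridVec_le (d := d) (a := a) hn0 hr0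
        linarith
    · simp [Store.nat_setNat, Store.nat_setReal, NatExpr.eval, c10]
    · simp [Store.nat_setNat, Store.nat_setReal, NatExpr.eval, c11, c0]
      ring
    · simpa [Store.nat_setNat, Store.nat_setReal] using h3c
  · simp [NatExpr.cost, RealExpr.cost]

/-- Computes all belief vectors and edges. -/
def exploreProg : Program :=
  .seq (set 6 (.const 1)) (.seq (set 7 types) (.loop (.natLt (var 8) (var 6))
    (.seq (set 10 (.const 0)) (.seq (set 11 (.const 0))
      (.seq (.loop (.natLt (var 10) categories) edgeProg)
        (.seq (inc 8 (.const 1)) (inc 9 types)))))))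

/-- The outer loop runs while j is below a count that itself grows. It ends because `hcard` bounds
every possible list by N; then j equals the count, and all edges of all listed beliefs are present.
-/
theorem exploreProg_spec {s : Store} {n d K N : ℕ} {q : ℕ → ℝ} {P : ℕ → ℕ → ℝ}
    (hK : s.nat 0 1 = K) (hd : s.nat 0 2 = d + 1) (hn : s.nat 5 0 = n) (hn0 : 0 < n)
    (hP : ∀ k m, P k m = s.real 0 (k * (d + 1) + m)) (hP0 : ∀ k < K, ∀ m < d + 1, 0 ≤ P k m)
    (hq : s.real 1 = q) (hq0 : ∀ m < d + 1, 0 ≤ q m) (h8 : s.nat 8 0 = 0) (h9 : s.nat 9 0 = 0)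
    (h16 : s.nat 16 = fun _ => 0) (h18 : s.nat 18 0 = 0)
    (hcard : ∀ cnt V B, Nodes n d q cnt V B → cnt ≤ N) :
    Ends exploreProg s (N * (K * (d * 300 + n * 50 + 410) + 60) + 30) fun s' =>
      Nodes n d q (s'.nat 6 0) (s'.nat 16) (s'.real 1) ∧
      Edges n d K P (s'.nat 6 0) (s'.nat 6 0 * K) (s'.real 1) (s'.nat 17) (s'.real 5) := by
  refine (Ends.seq_nat (Ends.seq_nat (Ends.loop
    (fun j s' => Exploring n d K q P j 0 s' ∧ j ≤ s'.nat 6 0)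
    N (K * (d * 300 + n * 50 + 410) + 50) ?_ ?_ ?_))).mono ?_ fun _ h => h
  · refine ⟨⟨?_, ?_, ?_, ?_, ?_, ?_⟩, Nat.zero_le _⟩
    · simpa [Store.nat_setNat_of_ne, Store.nat_setNat, Store.real_setNat, NatExpr.eval, h16, hq]
        using Nodes.start n d q
    · simp [Store.nat_setNat, NatExpr.eval, hd]
    · simp [Store.nat_setNat, h9]
    · simp [Store.nat_setNat, h8]
    · simp [Store.nat_setNat, h18]
    · rw [zero_mul, zero_add]
      exact Edges.start _ _ _ _ _ _ _ _
  · rintro j s' hk ⟨hX, hle⟩ hb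
    have a01 : s'.nat 0 1 = K := by
      rw [hk.nat 0 (by decide)]; simpa [Store.nat_setNat] using hK
    have a02 : s'.nat 0 2 = d + 1 := by
      rw [hk.nat 0 (by decide)]; simpa [Store.nat_setNat] using hd
    have a5 : s'.nat 5 0 = n := by
      rw [hk.nat 5 (by decide)]; simpa [Store.nat_setNat] using hn
    have r0 : s'.real 0 = s.real 0 := hk.real 0 (by decide)
    simp only [Test.Holds, NatExpr.eval, hX.index] at hb
    refine ⟨hb.trans_le (hcard _ _ _ hX.nodes), ?_⟩
    refine (Ends.seq_nat (Ends.seq_nat (Ends.seq_keeps (T' := 14) (Ends.loop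
      (fun k s'' => Exploring n d K q P j k s'' ∧ s''.nat 10 0 = k ∧ s''.nat 11 0 = k * (d + 1) ∧
        k ≤ K ∧ j < s''.nat 6 0) K (d * 300 + n * 50 + 400)
      (Q := fun s'' => Exploring n d K q P j K s'' ∧ j < s''.nat 6 0) ?_ ?_ ?_) ?_))).mono
      ?_ fun _ h => h
    · obtain ⟨e1, e2, e3, e4, e5, e6⟩ := hX
      refine ⟨⟨?_, ?_, ?_, ?_, ?_, ?_⟩, ?_, ?_, Nat.zero_le _, ?_⟩
      · simpa [Store.nat_setNat_of_ne, Store.real_setNat] using e1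
      · simpa [Store.nat_setNat] using e2
      · simpa [Store.nat_setNat] using e3
      · simpa [Store.nat_setNat] using e4
      · simpa [Store.nat_setNat] using e5
      · simpa [Store.nat_setNat_of_ne, Store.real_setNat] using e6
      · simp [Store.nat_setNat, NatExpr.eval]
      · simp [Store.nat_setNat, NatExpr.eval]
      · simpa [Store.nat_setNat] using hb
    · rintro k s'' hk' ⟨hX', h10, h11, -, hj⟩ hb'
      have b01 : s''.nat 0 1 = K := by
        rw [hk'.nat 0 (by decide)]; simpa [Store.nat_setNat] using a01
      have b02 : s''.nat 0 2 = d + 1 := by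
        rw [hk'.nat 0 (by decide)]; simpa [Store.nat_setNat] using a02
      have b5 : s''.nat 5 0 = n := by
        rw [hk'.nat 5 (by decide)]; simpa [Store.nat_setNat] using a5
      have t0 : s''.real 0 = s.real 0 := (hk'.real 0 (by decide)).trans r0
      simp only [Test.Holds, NatExpr.eval, h10, b01] at hb'
      refine ⟨hb', (edgeProg_spec hX' b02 b5 hn0 (fun k m => by rw [hP, t0]) hP0 hq0 hj hb' h10
        h11).mono le_rfl ?_⟩
      rintro s3 ⟨h1, h2, h3, h4⟩
      exact ⟨h1, h2, h3, hb', hj.trans_le h4⟩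
    · rintro k s'' hk' - ⟨hX', h10, h11, hle', hj⟩ hb'
      have b01 : s''.nat 0 1 = K := by
        rw [hk'.nat 0 (by decide)]; simpa [Store.nat_setNat] using a01
      simp only [Test.Holds, NatExpr.eval, h10, b01] at hb'
      obtain rfl : k = K := by omega
      exact ⟨hX', hj⟩
    · rintro s'' hk' ⟨hX', hj⟩
      have b02 : s''.nat 0 2 = d + 1 := by
        rw [hk'.nat 0 (by decide)]; simpa [Store.nat_setNat] using a02
      refine (Ends.seq_nat (Ends.assignNat (T := 7) ?_ (by simp [NatExpr.cost]))).mono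
        (by simp [NatExpr.cost]) fun _ h => h
      obtain ⟨e1, e2, e3, e4, e5, e6⟩ := hX'
      refine ⟨⟨?_, ?_, ?_, ?_, ?_, ?_⟩, ?_⟩
      · simpa [Store.nat_setNat_of_ne, Store.real_setNat] using e1
      · simpa [Store.nat_setNat] using e2
      · simp [Store.nat_setNat, NatExpr.eval, e3, b02]; ring
      · simp [Store.nat_setNat, NatExpr.eval, e4]
      · simp [Store.nat_setNat, e5]; ring
      · rw [← Nat.succ_mul] at e6
        simpa [Store.nat_setNat_of_ne, Store.real_setNat] using e6
      · simpa [Store.nat_setNat] using hj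
    · simp [NatExpr.cost, Test.cost]
      ring_nf
      omega
  · rintro j s' hk - ⟨hX, hle⟩ hb
    simp only [Test.Holds, NatExpr.eval, hX.index] at hb
    have : j = s'.nat 6 0 := by omega
    have hE := hX.edges
    rw [add_zero, this] at hE
    exact ⟨hX.nodes, hE⟩
  · simp [NatExpr.cost, Test.cost]
    ring_nf
    omega

end RealRAM

/-! ### Invariants of value iteration. -/

namespace BeliefGraph

/-- Value iteration in progress: the values of `h + 1` rounds are known for the belief vectors before
number `j`, and `k` recommendations have been tried for this one. `U` holds the values, `C` the best
recommendations and `X` the belief vectors that follow them; the entry for `h` rounds and belief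
vector `j` is at address `h * cnt + j`. -/
structure Partial (K cnt : ℕ) (E : ℕ → ℕ) (R : ℕ → ℝ) (h j k : ℕ) (U : ℕ → ℝ) (C X : ℕ → ℕ) :
    Prop where
  nonneg : ∀ l, 0 ≤ U l
  zero : ∀ l < cnt, U l = 0
  fresh : ∀ l, (h + 1) * cnt + j < l → U l = 0
  init : k = 0 → U ((h + 1) * cnt + j) = 0
  bound : ∀ i < k, R (j * K + i) * (1 + U (h * cnt + E (j * K + i))) ≤ U ((h + 1) * cnt + j)
  choice_lt : 0 < k → C ((h + 1) * cnt + j) < k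
  next : 0 < k → X ((h + 1) * cnt + j) = E (j * K + C ((h + 1) * cnt + j))
  eq : 0 < k → U ((h + 1) * cnt + j) = R (j * K + C ((h + 1) * cnt + j)) *
    (1 + U (h * cnt + E (j * K + C ((h + 1) * cnt + j))))
  done : ∀ h' j', j' < cnt → (h' + 1) * cnt + j' < (h + 1) * cnt + j →
    (∀ i < K, R (j' * K + i) * (1 + U (h' * cnt + E (j' * K + i))) ≤ U ((h' + 1) * cnt + j')) ∧
    C ((h' + 1) * cnt + j') < K ∧
    X ((h' + 1) * cnt + j') = E (j' * K + C ((h' + 1) * cnt + j')) ∧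
    U ((h' + 1) * cnt + j') = R (j' * K + C ((h' + 1) * cnt + j')) *
      (1 + U (h' * cnt + E (j' * K + C ((h' + 1) * cnt + j'))))

variable {K cnt : ℕ} {E : ℕ → ℕ} {R : ℕ → ℝ} {h j k : ℕ} {U : ℕ → ℝ} {C X : ℕ → ℕ}

theorem Partial.start (K cnt : ℕ) (E : ℕ → ℕ) (R : ℕ → ℝ) (C X : ℕ → ℕ) :
    Partial K cnt E R 0 0 0 (fun _ => 0) C X where
  nonneg _ := le_rfl
  zero _ _ := rfl
  fresh _ _ := rfl
  init _ := rfl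
  bound i hi := absurd hi (Nat.not_lt_zero i)
  choice_lt h := absurd h (lt_irrefl 0)
  next h := absurd h (lt_irrefl 0)
  eq h := absurd h (lt_irrefl 0)
  done h' j' _ hlt := by
    rw [Nat.succ_mul] at hlt
    omega

theorem Partial.keep (S : Partial K cnt E R h j k U C X) (hR : 0 ≤ R (j * K + k))
    (hlt : R (j * K + k) * (1 + U (h * cnt + E (j * K + k))) < U ((h + 1) * cnt + j)) :
    Partial K cnt E R h j (k + 1) U C X := by
  -- The first recommendation is never rejected: the entry still has its initial value 0 and the
  -- candidate is nonnegative. Hence a valid choice is on record whenever a candidate is rejected.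
  have hk : 0 < k := by
    rcases Nat.eq_zero_or_pos k with rfl | hk
    · rw [S.init rfl] at hlt
      exact absurd (mul_nonneg hR (by linarith [S.nonneg (h * cnt + E (j * K + 0))])) hlt.not_ge
    · exact hk
  refine ⟨S.nonneg, S.zero, S.fresh, fun h => absurd h (Nat.succ_ne_zero k), fun i hi => ?_,
    fun _ => (S.choice_lt hk).trans k.lt_succ_self, fun _ => S.next hk, fun _ => S.eq hk, S.done⟩
  rcases Nat.lt_succ_iff_lt_or_eq.1 hi with hi | rfl
  · exact S.bound i hi
  · exact hlt.le

theorem Partial.improve (S : Partial K cnt E R h j k U C X) (hR : 0 ≤ R (j * K + k)) (hj : j < cnt)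
    (hE : ∀ j < cnt, ∀ k < K, E (j * K + k) < cnt) (hk : k < K)
    (hle : U ((h + 1) * cnt + j) ≤ R (j * K + k) * (1 + U (h * cnt + E (j * K + k)))) :
    Partial K cnt E R h j (k + 1)
      (fun l => if l = (h + 1) * cnt + j then
        R (j * K + k) * (1 + U (h * cnt + E (j * K + k))) else U l)
      (fun l => if l = (h + 1) * cnt + j then k else C l)
      (fun l => if l = (h + 1) * cnt + j then E (j * K + k) else X l) := by
  have hcnt : cnt ≤ (h + 1) * cnt := Nat.le_mul_of_pos_left _ h.succ_pos
  -- Candidates read layer h, and the write is to layer h + 1, so recorded inequalities survive the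
  -- update.
  have hlow : ∀ i < K, h * cnt + E (j * K + i) ≠ (h + 1) * cnt + j := fun i hi => by
    have := hE j hj i hi
    rw [Nat.succ_mul]
    omega
  refine ⟨fun l => ?_, fun l hl => ?_, fun l hl => ?_, fun h => absurd h (Nat.succ_ne_zero k),
    fun i hi => ?_, fun _ => ?_, fun _ => ?_, fun _ => ?_, fun h' j' hj' hlt => ?_⟩
  · split_ifs
    · exact mul_nonneg hR (by linarith [S.nonneg (h * cnt + E (j * K + k))])
    · exact S.nonneg l
  · rw [if_neg (by omega)]
    exact S.zero l hl
  · rw [if_neg (by omega)]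
    exact S.fresh l hl
  · rw [if_pos rfl, if_neg (hlow i (by omega))]
    rcases Nat.lt_succ_iff_lt_or_eq.1 hi with hi | rfl
    · exact (S.bound i hi).trans hle
    · exact le_rfl
  · rw [if_pos rfl]
    exact k.lt_succ_self
  · rw [if_pos rfl, if_pos rfl]
  · rw [if_pos rfl, if_pos rfl, if_neg (hlow k hk)]
  · obtain ⟨h1, h2, h3, h4⟩ := S.done h' j' hj' hlt
    have hlow' : ∀ i < K, h' * cnt + E (j' * K + i) ≠ (h + 1) * cnt + j := fun i hi => by
      have := hE j' hj' i hi
      rw [Nat.succ_mul] at hlt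
      omega
    rw [if_neg hlt.ne, if_neg hlt.ne, if_neg hlt.ne, if_neg (hlow' _ h2)]
    refine ⟨fun i hi => ?_, h2, h3, h4⟩
    rw [if_neg (hlow' i hi)]
    exact h1 i hi

theorem Partial.next_vector (S : Partial K cnt E R h j K U C X) (hj : j < cnt) (hK : 0 < K) :
    Partial K cnt E R h (j + 1) 0 U C X := by
  refine ⟨S.nonneg, S.zero, fun l hl => S.fresh l (by omega), fun _ => S.fresh _ (by omega),
    fun i hi => absurd hi (Nat.not_lt_zero i), fun h => absurd h (lt_irrefl 0),
    fun h => absurd h (lt_irrefl 0), fun h => absurd h (lt_irrefl 0), fun h' j' hj' hlt => ?_⟩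
  by_cases heq : (h' + 1) * cnt + j' = (h + 1) * cnt + j
  · obtain ⟨h1, rfl⟩ := edge_inj hj' hj heq
    obtain rfl : h' = h := by omega
    exact ⟨S.bound, S.choice_lt hK, S.next hK, S.eq hK⟩
  · exact S.done h' j' hj' (by omega)

/-- Position `cnt` of one layer is position 0 of the next, so the target address simply runs on. -/
theorem Partial.next_layer (S : Partial K cnt E R h cnt 0 U C X) :
    Partial K cnt E R (h + 1) 0 0 U C X := by
  have heq : (h + 1 + 1) * cnt + 0 = (h + 1) * cnt + cnt := by ring
  refine ⟨S.nonneg, S.zero, fun l hl => S.fresh l (by omega), fun _ => by rw [heq]; exact S.init rfl,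
    fun i hi => absurd hi (Nat.not_lt_zero i), fun h => absurd h (lt_irrefl 0),
    fun h => absurd h (lt_irrefl 0), fun h => absurd h (lt_irrefl 0), fun h' j' hj' hlt => ?_⟩
  exact S.done h' j' hj' (by omega)

/-- The belief vectors that are visited when the best recommendations are followed. -/
def trace (H cnt : ℕ) (X : ℕ → ℕ) : ℕ → ℕ
  | 0 => 0
  | t + 1 => X ((H - t) * cnt + trace H cnt X t)

theorem layer_lt {h H j cnt : ℕ} (hh : h < H) (hj : j < cnt) :
    (h + 1) * cnt + j < (H + 1) * cnt + 0 := by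
  have := Nat.mul_le_mul_right cnt (Nat.succ_le_succ (Nat.succ_le_of_lt hh))
  rw [Nat.succ_mul] at this
  simp only [Nat.succ_eq_add_one] at this
  omega

/-- With H - t rounds left, layer H - t is consulted; it is H - (t + 1) + 1, so its entries fall
under `done`. -/
theorem Partial.trace_spec {H : ℕ} (S : Partial K cnt E R H 0 0 U C X) (hcnt : 0 < cnt)
    (hE : ∀ j < cnt, ∀ k < K, E (j * K + k) < cnt) {t : ℕ} (ht : t < H) :
    trace H cnt X t < cnt ∧ C ((H - t) * cnt + trace H cnt X t) < K ∧
    trace H cnt X (t + 1)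
      = E (trace H cnt X t * K + C ((H - t) * cnt + trace H cnt X t)) ∧
    U ((H - t) * cnt + trace H cnt X t)
      = R (trace H cnt X t * K + C ((H - t) * cnt + trace H cnt X t)) *
        (1 + U ((H - (t + 1)) * cnt
          + E (trace H cnt X t * K + C ((H - t) * cnt + trace H cnt X t)))) := by
  have key : ∀ t < H, trace H cnt X t < cnt → _ := fun t ht hlt => by
    have hd := S.done (H - (t + 1)) (trace H cnt X t) hlt (layer_lt (by omega) hlt)
    rw [show H - (t + 1) + 1 = H - t by omega] at hd
    exact hd.2
  have hlt : trace H cnt X t < cnt := by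
    induction t with
    | zero => exact hcnt
    | succ t ih =>
      have hlt := ih (by omega)
      obtain ⟨h1, h2, -⟩ := key t (by omega) hlt
      change X ((H - t) * cnt + trace H cnt X t) < cnt
      rw [h2]
      exact hE _ hlt _ h1
  obtain ⟨h1, h2, h3⟩ := key t ht hlt
  exact ⟨hlt, h1, h2, h3⟩

end BeliefGraph

/-! ### Programs for value iteration and for reading off the policy. -/

namespace RealRAM
open NatExpr Program BeliefGraph

/-- The value of the recommendation that is being tried. -/
def candidate : RealExpr :=
  .mul (.get 5 (var 18)) (.add (.cast (.const 1)) (.get 6 (.add (var 20) (.get 17 (var 18)))))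

/-- Tries a recommendation. -/
def tryProg : Program :=
  .seq (.cond (.neg (.realLt candidate (.get 6 (var 21))))
    (.seq (.assignReal 6 (var 21) candidate)
      (.seq (.assignNat 22 (var 21) (var 10)) (.assignNat 23 (var 21) (.get 17 (var 18))))) .skip)
    (.seq (inc 18 (.const 1)) (inc 10 (.const 1)))

/-- The variables of value iteration, and what is known. -/
structure Solving (K cnt : ℕ) (E : ℕ → ℕ) (R : ℕ → ℝ) (h j k : ℕ) (s : Store) : Prop where
  entries : Partial K cnt E R h j k (s.real 6) (s.nat 22) (s.nat 23)
  layer : s.nat 20 0 = h * cnt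
  target : s.nat 21 0 = (h + 1) * cnt + j
  edge : s.nat 18 0 = j * K + k

theorem tryProg_spec {s : Store} {K cnt h j k : ℕ} {E : ℕ → ℕ} {R : ℕ → ℝ}
    (hS : Solving K cnt E R h j k s) (hEs : s.nat 17 = E) (hRs : s.real 5 = R)
    (hR : ∀ j < cnt, ∀ k < K, 0 ≤ R (j * K + k)) (hE : ∀ j < cnt, ∀ k < K, E (j * K + k) < cnt)
    (hj : j < cnt) (hk : k < K) (h10 : s.nat 10 0 = k) :
    Ends tryProg s 100 fun s' => Solving K cnt E R h j (k + 1) s' ∧ s'.nat 10 0 = k + 1 := by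
  obtain ⟨hP, h20, h21, h18⟩ := hS
  refine ((Ends.cond (T := 50) (Q := fun s' => Partial K cnt E R h j (k + 1) (s'.real 6)
    (s'.nat 22) (s'.nat 23)) ?_ ?_).seq_keeps (T' := 20) ?_).mono ?_ fun _ h => h
  · intro hb
    simp only [Test.Holds, candidate, NatExpr.eval, RealExpr.eval, h20, h21, h18, hEs, hRs,
      not_lt, Nat.cast_one] at hb
    have := hP.improve (hR j hj k hk) hj hE hk hb
    refine (Ends.seq_real (Ends.seq_nat (Ends.assignNat (T := 7) ?_ (by simp [NatExpr.cost])))).mono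
      (by simp [NatExpr.cost, RealExpr.cost, candidate]) fun _ h => h
    convert this using 1
    · funext l
      simp [Store.real_setNat, Store.real_setReal, NatExpr.eval, RealExpr.eval, candidate, h20,
        h21, h18, hEs, hRs]
    · funext l
      simp [Store.nat_setNat, Store.nat_setReal, NatExpr.eval, h21, h10]
    · funext l
      simp [Store.nat_setNat, Store.nat_setReal, NatExpr.eval, h21, h18, hEs]
  · intro hb
    simp only [Test.Holds, candidate, NatExpr.eval, RealExpr.eval, h20, h21, h18, hEs, hRs,
      not_not, Nat.cast_one] at hb
    exact Ends.skip (hP.keep (hR j hj k hk) hb) (by norm_num)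
  · intro s' hk' hP'
    have a10 := congrFun (hk'.nat 10 (by decide)) 0
    have a18 := congrFun (hk'.nat 18 (by decide)) 0
    have a20 := congrFun (hk'.nat 20 (by decide)) 0
    have a21 := congrFun (hk'.nat 21 (by decide)) 0
    rw [h10] at a10; rw [h18] at a18; rw [h20] at a20; rw [h21] at a21
    refine (Ends.seq_nat (Ends.assignNat (T := 6) ?_ (by simp [NatExpr.cost]))).mono
      (by simp [NatExpr.cost]) fun _ h => h
    refine ⟨⟨?_, ?_, ?_, ?_⟩, ?_⟩
    · simpa [Store.nat_setNat_of_ne, Store.real_setNat] using hP'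
    · simpa [Store.nat_setNat] using a20
    · simpa [Store.nat_setNat] using a21
    · simp [Store.nat_setNat, NatExpr.eval, a18, add_assoc]
    · simp [Store.nat_setNat, NatExpr.eval, a10]
  · simp [Test.cost, NatExpr.cost, RealExpr.cost, candidate]

/-- Computes the values of all belief vectors for one more round. -/
def layerProg : Program :=
  .loop (.natLt (var 8) (var 6)) (.seq (set 10 (.const 0))
    (.seq (.loop (.natLt (var 10) categories) tryProg)
      (.seq (inc 8 (.const 1)) (inc 21 (.const 1)))))

theorem layerProg_spec {s : Store} {K cnt h : ℕ} {E : ℕ → ℕ} {R : ℕ → ℝ}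
    (hS : Solving K cnt E R h 0 0 s) (hEs : s.nat 17 = E) (hRs : s.real 5 = R)
    (hR : ∀ j < cnt, ∀ k < K, 0 ≤ R (j * K + k)) (hE : ∀ j < cnt, ∀ k < K, E (j * K + k) < cnt)
    (hK : s.nat 0 1 = K) (hK0 : 0 < K) (hcnt : s.nat 6 0 = cnt) (h8 : s.nat 8 0 = 0) :
    Ends layerProg s (cnt * (K * 105 + 40) + 5) fun s' => Solving K cnt E R h cnt 0 s' := by
  refine (Ends.loop (fun j s' => Solving K cnt E R h j 0 s' ∧ s'.nat 8 0 = j ∧ j ≤ cnt)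
    cnt (K * 105 + 30) ?_ ?_ ?_).mono ?_ fun _ h => h
  · exact ⟨hS, h8, Nat.zero_le _⟩
  · rintro j s' hk ⟨hS', hj8, -⟩ hb
    have a0 : s'.nat 0 = s.nat 0 := hk.nat 0 (by decide)
    have a6 : s'.nat 6 = s.nat 6 := hk.nat 6 (by decide)
    have a17 : s'.nat 17 = E := (hk.nat 17 (by decide)).trans hEs
    have r5 : s'.real 5 = R := (hk.real 5 (by decide)).trans hRs
    simp only [Test.Holds, NatExpr.eval, hj8, a6, hcnt] at hb
    refine ⟨hb, (Ends.seq_nat (Ends.seq_keeps (T' := 12) (Ends.loop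
      (fun k s'' => Solving K cnt E R h j k s'' ∧ s''.nat 10 0 = k ∧ k ≤ K) K 100
      (Q := fun s'' => Solving K cnt E R h j K s'') ?_ ?_ ?_) ?_)).mono ?_ fun _ h => h⟩
    · obtain ⟨e1, e2, e3, e4⟩ := hS'
      refine ⟨⟨?_, ?_, ?_, ?_⟩, ?_, Nat.zero_le _⟩
      · simpa [Store.nat_setNat_of_ne, Store.real_setNat] using e1
      · simpa [Store.nat_setNat] using e2
      · simpa [Store.nat_setNat] using e3
      · simpa [Store.nat_setNat] using e4
      · simp [Store.nat_setNat, NatExpr.eval]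
    · rintro k s'' hk' ⟨hS'', h10, -⟩ hb'
      have b0 : s''.nat 0 = s.nat 0 := (hk'.nat 0 (by decide)).trans a0
      have b17 : s''.nat 17 = E := (hk'.nat 17 (by decide)).trans a17
      have t5 : s''.real 5 = R := (hk'.real 5 (by decide)).trans r5
      simp only [Test.Holds, NatExpr.eval, h10, b0, hK] at hb'
      exact ⟨hb', (tryProg_spec hS'' b17 t5 hR hE hb hb' h10).mono le_rfl
        fun _ h' => ⟨h'.1, h'.2, hb'⟩⟩
    · rintro k s'' hk' - ⟨hS'', h10, hle⟩ hb'
      have b0 : s''.nat 0 = s.nat 0 := (hk'.nat 0 (by decide)).trans a0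
      simp only [Test.Holds, NatExpr.eval, h10, b0, hK] at hb'
      obtain rfl : k = K := by omega
      exact hS''
    · rintro s'' hk' ⟨e1, e2, e3, e4⟩
      have b8 : s''.nat 8 0 = j := by
        rw [hk'.nat 8 (by decide)]; simpa [Store.nat_setNat] using hj8
      refine (Ends.seq_nat (Ends.assignNat (T := 6) ?_ (by simp [NatExpr.cost]))).mono
        (by simp [NatExpr.cost]) fun _ h => h
      refine ⟨⟨?_, ?_, ?_, ?_⟩, ?_, hb⟩
      · simpa [Store.nat_setNat_of_ne, Store.real_setNat] using e1.next_vector hb hK0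
      · simpa [Store.nat_setNat] using e2
      · simp [Store.nat_setNat, NatExpr.eval, e3, add_assoc]
      · simp [Store.nat_setNat, e4]; ring
      · simp [Store.nat_setNat, NatExpr.eval, b8]
    · simp [NatExpr.cost, Test.cost]
      omega
  · rintro j s' hk - ⟨hS', hj8, hle⟩ hb
    have a6 : s'.nat 6 = s.nat 6 := hk.nat 6 (by decide)
    simp only [Test.Holds, NatExpr.eval, hj8, a6, hcnt] at hb
    obtain rfl : j = cnt := by omega
    exact hS'
  · simp [NatExpr.cost, Test.cost]
    ring_nf
    omega

/-- Value iteration. -/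
def valueProg : Program :=
  .seq (set 21 (var 6)) (.loop (.natLt (var 19) horizon)
    (.seq (set 18 (.const 0)) (.seq (set 8 (.const 0)) (.seq layerProg
      (.seq (inc 20 (var 6)) (inc 19 (.const 1)))))))

theorem valueProg_spec {s : Store} {H K cnt : ℕ} {E : ℕ → ℕ} {R : ℕ → ℝ}
    (hEs : s.nat 17 = E) (hRs : s.real 5 = R)
    (hR : ∀ j < cnt, ∀ k < K, 0 ≤ R (j * K + k)) (hE : ∀ j < cnt, ∀ k < K, E (j * K + k) < cnt)
    (hH : s.nat 0 0 = H) (hK : s.nat 0 1 = K) (hK0 : 0 < K) (hcnt : s.nat 6 0 = cnt)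
    (h19 : s.nat 19 0 = 0) (h20 : s.nat 20 0 = 0) (h6 : s.real 6 = fun _ => 0) :
    Ends valueProg s (H * (cnt * (K * 105 + 40) + 40) + 10) fun s' =>
      Partial K cnt E R H 0 0 (s'.real 6) (s'.nat 22) (s'.nat 23) ∧ s'.nat 20 0 = H * cnt := by
  refine (Ends.seq_nat (Ends.loop (fun h s' => Partial K cnt E R h 0 0 (s'.real 6) (s'.nat 22)
      (s'.nat 23) ∧ s'.nat 20 0 = h * cnt ∧ s'.nat 21 0 = (h + 1) * cnt ∧ s'.nat 19 0 = h ∧ h ≤ H)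
    H (cnt * (K * 105 + 40) + 30) ?_ ?_ ?_)).mono ?_ fun _ h => h
  · refine ⟨?_, ?_, ?_, ?_, Nat.zero_le _⟩
    · simpa [Store.nat_setNat_of_ne, Store.real_setNat, h6] using
        Partial.start K cnt E R (s.nat 22) (s.nat 23)
    · simpa [Store.nat_setNat] using h20
    · simp [Store.nat_setNat, NatExpr.eval, hcnt]
    · simpa [Store.nat_setNat] using h19
  · rintro h s' hk ⟨hP, hs20, hs21, hs19, -⟩ hb
    have a00 : s'.nat 0 0 = H := by
      rw [hk.nat 0 (by decide)]; simpa [Store.nat_setNat] using hH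
    have a01 : s'.nat 0 1 = K := by
      rw [hk.nat 0 (by decide)]; simpa [Store.nat_setNat] using hK
    have a6 : s'.nat 6 0 = cnt := by
      rw [hk.nat 6 (by decide)]; simpa [Store.nat_setNat] using hcnt
    have a17 : s'.nat 17 = E := by
      rw [hk.nat 17 (by decide)]; simpa [Store.nat_setNat_of_ne] using hEs
    have r5 : s'.real 5 = R := (hk.real 5 (by decide)).trans hRs
    simp only [Test.Holds, NatExpr.eval, hs19, a00] at hb
    refine ⟨hb, (Ends.seq_nat (Ends.seq_nat (Ends.seq_keeps (T' := 13) (layerProg_spec (K := K)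
      (cnt := cnt) (h := h) (E := E) (R := R) ⟨?_, ?_, ?_, ?_⟩ ?_ ?_ hR hE ?_ hK0 ?_ ?_)
      ?_))).mono ?_ fun _ h => h⟩
    · simpa [Store.nat_setNat_of_ne, Store.real_setNat] using hP
    · simpa [Store.nat_setNat] using hs20
    · simpa [Store.nat_setNat] using hs21
    · simp [Store.nat_setNat, NatExpr.eval]
    · simpa [Store.nat_setNat_of_ne] using a17
    · exact r5
    · simpa [Store.nat_setNat] using a01
    · simpa [Store.nat_setNat] using a6
    · simp [Store.nat_setNat, NatExpr.eval]
    · rintro s'' hk' ⟨e1, e2, e3, e4⟩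
      have b6 : s''.nat 6 0 = cnt := by
        rw [hk'.nat 6 (by decide)]; simpa [Store.nat_setNat] using a6
      have b19 : s''.nat 19 0 = h := by
        rw [hk'.nat 19 (by decide)]; simpa [Store.nat_setNat] using hs19
      refine (Ends.seq_nat (Ends.assignNat (T := 6) ?_ (by simp [NatExpr.cost]))).mono
        (by simp [NatExpr.cost]) fun _ h => h
      refine ⟨?_, ?_, ?_, ?_, hb⟩
      · simpa [Store.nat_setNat_of_ne, Store.real_setNat] using e1.next_layer
      · simp [Store.nat_setNat, NatExpr.eval, e2, b6]; ring
      · simp [Store.nat_setNat, e3]; ring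
      · simp [Store.nat_setNat, NatExpr.eval, b19]
    · simp [NatExpr.cost]
      omega
  · rintro h s' hk - ⟨hP, hs20, hs21, hs19, hle⟩ hb
    have a00 : s'.nat 0 0 = H := by
      rw [hk.nat 0 (by decide)]; simpa [Store.nat_setNat] using hH
    simp only [Test.Holds, NatExpr.eval, hs19, a00] at hb
    obtain rfl : h = H := by omega
    exact ⟨hP, hs20⟩
  · simp [NatExpr.cost, Test.cost]
    ring_nf
    omega

/-- Writes the answer. -/
def traceProg : Program :=
  .loop (.natLt (var 24) horizon)
    (.seq (.assignNat 1 (var 24) (.get 22 (.add (var 20) (var 25))))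
      (.seq (set 25 (.get 23 (.add (var 20) (var 25))))
        (.seq (set 20 (.sub (var 20) (var 6))) (inc 24 (.const 1)))))

/-- Subtracting the number of beliefs from variable `20` in each round descends one layer without a
multiplication. -/
theorem traceProg_spec {s : Store} {H cnt : ℕ} (hH : s.nat 0 0 = H) (hcnt : s.nat 6 0 = cnt)
    (h20 : s.nat 20 0 = H * cnt) (h24 : s.nat 24 0 = 0) (h25 : s.nat 25 0 = 0) :
    Ends traceProg s (H * 50 + 5) fun s' => ∀ t < H,
      s'.nat 1 t = s.nat 22 ((H - t) * cnt + trace H cnt (s.nat 23) t) := by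
  refine (Ends.loop (fun t s' => s'.nat 24 0 = t ∧ s'.nat 20 0 = (H - t) * cnt ∧
      s'.nat 25 0 = trace H cnt (s.nat 23) t ∧ t ≤ H ∧
      ∀ i < t, s'.nat 1 i = s.nat 22 ((H - i) * cnt + trace H cnt (s.nat 23) i))
    H 40 ?_ ?_ ?_).mono ?_ fun _ h => h
  · exact ⟨h24, h20, h25, Nat.zero_le _, fun i hi => absurd hi (Nat.not_lt_zero i)⟩
  · rintro t s' hk ⟨h1, h2, h3, -, h5⟩ hb
    have a0 : s'.nat 0 0 = H := by rw [hk.nat 0 (by decide), hH]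
    have a6 : s'.nat 6 0 = cnt := by rw [hk.nat 6 (by decide), hcnt]
    have a22 := hk.nat 22 (by decide)
    have a23 := hk.nat 23 (by decide)
    simp only [Test.Holds, NatExpr.eval, h1, a0] at hb
    refine ⟨hb, (Ends.seq_nat (Ends.seq_nat (Ends.seq_nat (Ends.assignNat (T := 6) ?_
      (by simp [NatExpr.cost]))))).mono (by simp [NatExpr.cost]) fun _ h => h⟩
    refine ⟨?_, ?_, ?_, hb, fun i hi => ?_⟩
    · simp [Store.nat_setNat, NatExpr.eval, h1]
    · simp [Store.nat_setNat, NatExpr.eval, h2, a6]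
      rw [show H - t = H - (t + 1) + 1 by omega, Nat.succ_mul, Nat.add_sub_cancel]
    · simp [Store.nat_setNat, NatExpr.eval, h2, h3, a23, trace]
    · by_cases hit : i = t
      · simp [Store.nat_setNat, NatExpr.eval, h1, h2, h3, a22, hit]
      · simp [Store.nat_setNat, NatExpr.eval, h1, hit, h5 i (by omega)]
  · rintro t s' hk - ⟨h1, h2, h3, hle, h5⟩ hb
    have a0 : s'.nat 0 0 = H := by rw [hk.nat 0 (by decide), hH]
    simp only [Test.Holds, NatExpr.eval, h1, a0] at hb
    obtain rfl : t = H := by omega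
    exact h5
  · simp [NatExpr.cost, Test.cost]
    omega

end RealRAM

/-! ### The whole algorithm and its input. -/

namespace RealRAM
open NatExpr Program BeliefGraph GridRounding ApproxDP

/-- Computes the answer for a matrix whose largest entry is in real variable `3`. -/
def solveProg : Program :=
  .seq gridProg (.seq exploreProg (.seq valueProg traceProg))

theorem rounding_error_le {ε p : ℝ} {d n : ℕ} (hp0 : 0 ≤ p) (hp1 : p < 1) (hn : 1 ≤ n)
    (h : (d : ℝ) ≤ n * (ε * ((1 - p) * (1 - p)))) :
    (d : ℝ) / n * p * (p / (1 - p)) / (1 - p) ≤ ε := by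
  have h1p : 0 < 1 - p := by linarith
  have hn' : (0 : ℝ) < n := by exact_mod_cast hn
  have h1 : (d : ℝ) / n ≤ ε * ((1 - p) * (1 - p)) := by rwa [div_le_iff₀ hn', mul_comm]
  have h2 : p * p ≤ 1 := mul_le_one₀ hp1.le hp0 hp1.le
  have h3 : (0 : ℝ) ≤ d / n := by positivity
  calc (d : ℝ) / n * p * (p / (1 - p)) / (1 - p)
      = (d : ℝ) / n * (p * p) / ((1 - p) * (1 - p)) := by field_simp
    _ ≤ ε := by
      rw [div_le_iff₀ (mul_pos h1p h1p)]
      exact (mul_le_of_le_one_right h3 h2).trans h1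

/-- The optimum is at most the table value of the prior plus ε, and the output is worth at least
that table value. Here `n` and `N` are bounds for the resolution and the number of beliefs, stated
so that floors can be inserted; the computed numbers may be smaller. -/
theorem solveProg_spec {s : Store} {H K d n N : ℕ} {x ε p : ℝ} {q : ℕ → ℝ} {P : ℕ → ℕ → ℝ}
    (hH : s.nat 0 0 = H) (hK : s.nat 0 1 = K) (hd : s.nat 0 2 = d + 1) (hH0 : 0 < H) (hK0 : 0 < K)
    (hε : s.real 2 0 = ε) (hp : s.real 3 0 = p) (hp0 : 0 ≤ p) (hp1 : p < 1) (hε0 : 0 < ε)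
    (hx : x = 1 / (ε * (1 - p) ^ 2)) (hx4 : 4 ≤ x) (hn : (d : ℝ) * x + 1 < n + 1)
    (hN : 1 + 2 * (4 * x) ^ d < N + 1)
    (hP : ∀ k m, P k m = s.real 0 (k * (d + 1) + m)) (hP0 : ∀ k < K, ∀ m < d + 1, 0 ≤ P k m)
    (hPp : ∀ k < K, ∀ m < d + 1, P k m ≤ p)
    (hq : s.real 1 = q) (hq0 : ∀ m < d + 1, 0 ≤ q m) (hq1 : ∑ m ∈ Finset.range (d + 1), q m ≤ 1)
    (hz : ∀ a, 5 ≤ a → s.nat a = fun _ => 0) (hz6 : s.real 6 = fun _ => 0) :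
    Ends solveProg s (N * (K * (d * 300 + n * 50 + 410) + 60) +
        H * (N * (K * 105 + 40) + 90) + n * 32 + 200) fun s' =>
      (∀ t < H, s'.nat 1 t < K) ∧ ∀ π π' : ℕ → ℕ, (∀ t, π t < K) → (∀ t, π' t < K) →
        (∀ t < H, π t = s'.nat 1 t) →
        linValue (d + 1) P H π' q ≤ linValue (d + 1) P H π q + ε := by
  have h1p : 0 < 1 - p := by linarith
  set y : ℝ := ε * ((1 - p) * (1 - p)) with hy
  have hy0 : 0 < y := by positivity
  have hxy : (d : ℝ) / y = d * x := by rw [hx, hy, pow_two, mul_one_div]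
  have hceil : ⌈(d : ℝ) / y⌉₊ ≤ n := by
    refine Nat.lt_succ_iff.1 ((Nat.ceil_lt_add_one (by positivity)).trans ?_ |> Nat.cast_lt.1)
    push_cast
    rwa [hxy]
  refine ((gridProg_spec (by rw [hε, hp]) hy0 hd).seq_keeps
    (T' := N * (K * (d * 300 + n * 50 + 410) + 60) +
        H * (N * (K * 105 + 40) + 90) + 100) ?_).mono (by omega) fun _ h => h
  rintro s1 hk1 ⟨hn1, hdn, hnx⟩
  obtain ⟨n1, hn1_def⟩ : ∃ n1, s1.nat 5 0 = n1 := ⟨_, rfl⟩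
  rw [hn1_def] at hn1 hdn hnx
  rw [hxy] at hnx
  have hn1n : n1 ≤ n := Nat.lt_succ_iff.1 (Nat.cast_lt (α := ℝ).1 (by push_cast; linarith))
  have a0 := hk1.nat 0 (by decide)
  have a8 := hk1.nat 8 (by decide)
  have a9 := hk1.nat 9 (by decide)
  have a16 := hk1.nat 16 (by decide)
  have a18 := hk1.nat 18 (by decide)
  have a19 := hk1.nat 19 (by decide)
  have a20 := hk1.nat 20 (by decide)
  have a24 := hk1.nat 24 (by decide)
  have a25 := hk1.nat 25 (by decide)
  rw [hz _ (by norm_num)] at a8 a9 a16 a18 a19 a20 a24 a25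
  have r0 := hk1.real 0 (by decide)
  have r1 := (hk1.real 1 (by decide)).trans hq
  have r6 := (hk1.real 6 (by decide)).trans hz6
  have hcard : ∀ cnt V B, Nodes n1 d q cnt V B → cnt ≤ N := fun cnt V B hNo => by
    have h1 := hNo.card_le (x := x) (by linarith)
    have h2 := grid_bound hx4 hnx
    exact Nat.lt_succ_iff.1 (Nat.cast_lt (α := ℝ).1 (by push_cast; linarith))
  refine ((exploreProg_spec (s := s1) (K := K) (d := d) (P := P) (by rw [a0, hK]) (by rw [a0, hd])
    hn1_def hn1 (fun k m => by rw [hP, r0]) hP0 r1 hq0 (by rw [a8]) (by rw [a9]) a16 (by rw [a18])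
    hcard).seq_keeps (T' := H * (N * (K * 105 + 40) + 90) + 20) ?_).mono ?_ fun _ h => h
  swap
  · have : N * (K * (d * 300 + n1 * 50 + 410) + 60) ≤ N * (K * (d * 300 + n * 50 + 410) + 60) := by
      gcongr
    linarith
  rintro s2 hk2 ⟨hNo, hEd⟩
  have hcN := hcard _ _ _ hNo
  have hT := hEd.table hNo hq0 hq1
  set cnt := s2.nat 6 0 with hcnt
  have b0 := (hk2.nat 0 (by decide)).trans a0
  have b19 := (hk2.nat 19 (by decide)).trans a19
  have b20 := (hk2.nat 20 (by decide)).trans a20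
  have b24 := (hk2.nat 24 (by decide)).trans a24
  have b25 := (hk2.nat 25 (by decide)).trans a25
  have t6 := (hk2.real 6 (by decide)).trans r6
  refine ((valueProg_spec (s := s2) (K := K) (cnt := cnt) (H := H) rfl rfl
    (fun j hj k hk => (hT.prob_bounds hP0 hPp hp0 hj hk).1) hT.next_lt (by rw [b0, hH])
    (by rw [b0, hK]) hK0 rfl (by rw [b19]) (by rw [b20]) t6).seq_keeps (T' := H * 50 + 5)
    ?_).mono ?_ fun _ h => h
  swap
  · have : H * (cnt * (K * 105 + 40) + 40) ≤ H * (N * (K * 105 + 40) + 40) := by gcongr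
    have h2 : H * (N * (K * 105 + 40) + 90) = H * (N * (K * 105 + 40) + 40) + H * 50 := by ring
    linarith
  rintro s3 hk3 ⟨hPa, c20⟩
  have c0 := (hk3.nat 0 (by decide)).trans b0
  have c6 := hk3.nat 6 (by decide)
  have c24 := (hk3.nat 24 (by decide)).trans b24
  have c25 := (hk3.nat 25 (by decide)).trans b25
  refine (traceProg_spec (s := s3) (H := H) (cnt := cnt) (by rw [c0, hH]) (by rw [c6]) c20
    (by rw [c24]) (by rw [c25])).mono le_rfl ?_
  intro s4 hout
  have htr := fun t ht => hPa.trace_spec hNo.pos hT.next_lt (t := t) ht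
  refine ⟨fun t ht => by rw [hout t ht]; exact (htr t ht).2.1, ?_⟩
  intro π π' hπ hπ' hagree
  have hq' : ∀ ρ : ℕ → ℕ, linValue (d + 1) P H ρ (fun m => s2.real 1 (0 * (d + 1) + m))
      = linValue (d + 1) P H ρ q := fun ρ => by
    refine Finset.sum_congr rfl fun m hm => ?_
    simp only [zero_mul, zero_add]
    rw [hNo.prior m (Finset.mem_range.1 hm)]
  -- State 0 is the prior itself, unrounded, so both estimates start from the exact belief q.
  have hup := hT.linValue_le hP0 hPp hp0 hp1 (by positivity)
    (U := fun h j => s3.real 6 (h * cnt + j)) (fun j => hPa.nonneg _) H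
    (fun h hh j hj k hk => (hPa.done h j hj (layer_lt hh hj)).1 k hk) le_rfl hNo.pos hπ'
  have hlow := hT.le_linValue hP0 (U := fun h j => s3.real 6 (h * cnt + j))
    (fun j hj => by simp only [zero_mul, zero_add]; exact hPa.zero j hj)
    (cur := trace H cnt (s3.nat 23)) hπ (H := H) (fun t ht => (htr t ht).1)
    (fun t ht => by rw [hagree t (by omega), hout t (by omega)]; exact (htr t (by omega)).2.2.1)
    (fun t ht => by rw [hagree t ht, hout t ht]; exact (htr t ht).2.2.2) H 0 hH0 (zero_add H)
  simp only [zero_add, trace] at hlow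
  rw [hq'] at hup hlow
  have herr := rounding_error_le hp0 hp1 hn1 hdn
  linarith

/-- The algorithm. -/
def mainProg : Program :=
  .seq sizeProg (.seq maxProg
    (.cond (.realLt (.mul (.var 2) (.sub (.cast (.const 1)) (.var 3))) (.var 3)) solveProg .skip))

section Input

variable {nK d : ℕ} (I : RecAPC (Fin nK) (Fin (d + 1))) (H : ℕ) (ε : ℝ)

theorem input_pref (k : Fin nK) (m : Fin (d + 1)) :
    (input I H ε).real 0 (k * (d + 1) + m) = I.pref k m := by
  have h : (k : ℕ) * (d + 1) + m < nK * (d + 1) := cell_lt k.2 m.2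
  have h1 : Fin.divNat (⟨(k : ℕ) * (d + 1) + m, h⟩ : Fin (nK * (d + 1))) = k := by
    ext
    simp only [Fin.coe_divNat]
    rw [mul_comm, Nat.mul_add_div d.succ_pos, Nat.div_eq_of_lt m.2, add_zero]
  have h2 : Fin.modNat (⟨(k : ℕ) * (d + 1) + m, h⟩ : Fin (nK * (d + 1))) = m := by
    ext
    simp only [Fin.coe_modNat]
    rw [mul_comm, Nat.mul_add_mod, Nat.mod_eq_of_lt m.2]
  simp only [input, if_true, dif_pos h, h1, h2]

theorem input_prior (m : Fin (d + 1)) : (input I H ε).real 1 m = I.prior m := by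
  simp only [input, one_ne_zero, if_false, if_true, dif_pos m.2]

theorem value_eq_linValue (π : RecAPC.Policy (Fin nK)) :
    I.value H π = linValue (d + 1) (fun k m => (input I H ε).real 0 (k * (d + 1) + m)) H
      (fun t => π t) ((input I H ε).real 1) := by
  rw [RecAPC.value_eq, linValue, Finset.sum_range]
  refine Finset.sum_congr rfl fun m _ => ?_
  rw [input_prior]
  simp only [input_pref]

theorem pref_le_pMax (k : Fin nK) (m : Fin (d + 1)) : (I.pref k m : ℝ) ≤ I.pMax :=
  le_ciSup (f := fun x : Fin nK × Fin (d + 1) => (I.pref x.1 x.2 : ℝ))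
    (Set.finite_range _).bddAbove (k, m)

theorem pMax_nonneg : 0 ≤ I.pMax := Real.iSup_nonneg fun x => (I.pref x.1 x.2).2.1

variable {I H ε}

theorem max_eq_pMax (hK : 0 < nK) {p : ℝ}
    (h1 : ∀ i < nK * (d + 1), (input I H ε).real 0 i ≤ p) (h0 : 0 ≤ p)
    (h2 : p = 0 ∨ ∃ i < nK * (d + 1), p = (input I H ε).real 0 i) : p = I.pMax := by
  refine le_antisymm ?_ ?_
  · rcases h2 with rfl | ⟨i, hi, rfl⟩
    · exact pMax_nonneg I
    · simp only [input, if_true, dif_pos hi]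
      exact pref_le_pMax I _ _
  · have : Nonempty (Fin nK × Fin (d + 1)) := ⟨(⟨0, hK⟩, 0)⟩
    refine ciSup_le fun x => ?_
    rw [← input_pref I H ε]
    exact h1 _ (cell_lt x.1.2 x.2.2)

theorem value_nonneg (π : RecAPC.Policy (Fin nK)) : 0 ≤ I.value H π := by
  rw [RecAPC.value_eq]
  exact Finset.sum_nonneg fun m _ => mul_nonneg (I.prior.2.1 m)
    (RecAPC.expectedLikes_nonneg (fun t => (I.pref (π t) m).2.1) H)

/-- This makes every answer good enough when p ≤ ε (1 - p). -/
theorem value_le (hp : I.pMax < 1) (π : RecAPC.Policy (Fin nK)) :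
    I.value H π ≤ I.pMax / (1 - I.pMax) := by
  rw [RecAPC.value_eq]
  calc _ ≤ ∑ m, I.prior m * (I.pMax / (1 - I.pMax)) := Finset.sum_le_sum fun m _ =>
        mul_le_mul_of_nonneg_left (RecAPC.expectedLikes_le hp H (fun t => (I.pref (π t) m).2.1)
          fun t => pref_le_pMax I _ _) (I.prior.2.1 m)
    _ = _ := by
      rw [← Finset.sum_mul]
      have : ∑ m, I.prior m = 1 := I.prior.2.2
      rw [this, one_mul]

/-- The bound `T` and the condition `Q` for the last test are left open because its two outcomes
need different ones. Integer arrays 2, 3, 4 and real array 3 are the scratch space used up to there.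
-/
theorem mainProg_ends (hK : 0 < nK) {T : ℕ} {Q : Store → Prop}
    (hQ : ∀ s, (∀ a, 5 ≤ a ∨ a = 0 ∨ a = 1 → s.nat a = (input I H ε).nat a) →
      (∀ a, a ≠ 3 → s.real a = (input I H ε).real a) → s.real 3 0 = I.pMax →
      Ends (.cond (.realLt (.mul (.var 2) (.sub (.cast (.const 1)) (.var 3))) (.var 3))
        solveProg .skip) s T Q) :
    Ends mainProg (input I H ε) (nK * 18 + 5 + (nK * (d + 1) * 24 + 5 + T)) Q := by
  refine (sizeProg_spec (s := input I H ε) rfl rfl).seq_keeps fun s1 hk1 h1 => ?_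
  have hKM : s1.nat 3 0 = nK * (d + 1) := h1
  have hmax := maxProg_spec (s := s1) (congrFun (hk1.nat 4 (by decide)) 0)
    (congrFun (hk1.real 3 (by decide)) 0)
  rw [hKM] at hmax
  refine hmax.seq_keeps fun s2 hk2 ⟨h2, h3, h4⟩ => hQ s2 (fun a ha => ?_) (fun a ha => ?_) ?_
  · rw [hk2.nat a, hk1.nat a]
    · simp only [sizeProg, natWrites, List.mem_append, List.mem_singleton]
      clear h4
      omega
    · simp [maxProg, natWrites]
      clear h4
      omega
  · rw [hk2.real a, hk1.real a]
    · simp [sizeProg, realWrites]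
    · simpa [maxProg, realWrites] using ha
  · rw [hk1.real 0 (by decide)] at h2 h4
    exact max_eq_pMax hK h2 h3 h4

end Input

end RealRAM

/-! ### The step count and the conclusion. -/

theorem steps_bound {H K d n N : ℕ} {x : ℝ} (hH : 1 ≤ H) (hK : 1 ≤ K) (hx : 4 ≤ x)
    (hn : (n : ℝ) ≤ d * x + 1) (hN : (N : ℝ) ≤ 1 + 2 * (4 * x) ^ d) :
    ((K * 18 + 5 + (K * (d + 1) * 24 + 5 + (20 + (N * (K * (d * 300 + n * 50 + 410) + 60) +
        H * (N * (K * 105 + 40) + 90) + n * 32 + 200))) : ℕ) : ℝ)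
      ≤ 10000 * ((H : ℝ) * K * (d + 1 : ℕ) * x ^ (2 * d)) := by
  set X := x ^ (2 * d) with hX
  have hx0 : 0 < x := by linarith
  have hH' : (1 : ℝ) ≤ H := by exact_mod_cast hH
  have hK' : (1 : ℝ) ≤ K := by exact_mod_cast hK
  have hd0 : (0 : ℝ) ≤ d := Nat.cast_nonneg d
  have h4X : (4 * x) ^ d ≤ X := by
    rw [hX, pow_mul]
    exact pow_le_pow_left₀ (by linarith) (by nlinarith) d
  have h1 : 1 ≤ (4 * x) ^ d := one_le_pow₀ (by linarith)
  -- This is the term from the resolution n. For positive d one factor 4x joins the extra x to give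
  -- 4x², and the other factors satisfy 4x ≤ x². For d = 0 the term vanishes.
  have h4x : (d : ℝ) * x * (4 * x) ^ d ≤ 4 * d * X := by
    rcases d with _ | d
    · simp
    · have : x * (4 * x) ^ (d + 1) ≤ 4 * X := by
        calc x * (4 * x) ^ (d + 1) = 4 * x ^ 2 * (4 * x) ^ d := by ring
          _ ≤ 4 * x ^ 2 * (x ^ 2) ^ d := by
            refine mul_le_mul_of_nonneg_left ?_ (by positivity)
            exact pow_le_pow_left₀ (by linarith) (by nlinarith) d
          _ = 4 * X := by rw [hX]; ring
      calc _ = ((d + 1 : ℕ) : ℝ) * (x * (4 * x) ^ (d + 1)) := by ring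
        _ ≤ ((d + 1 : ℕ) : ℝ) * (4 * X) := mul_le_mul_of_nonneg_left this hd0
        _ = _ := by ring
  have hdx : (d : ℝ) * x ≤ 4 * d * X := by
    refine le_trans ?_ h4x
    nlinarith [mul_nonneg hd0 hx0.le]
  have hN3 : (N : ℝ) ≤ 3 * (4 * x) ^ d := by linarith
  have hNX : (N : ℝ) ≤ 3 * X := by linarith
  have hN0 : (0 : ℝ) ≤ N := Nat.cast_nonneg N
  have hNn : (N : ℝ) * n ≤ 12 * (d + 1) * X := by
    calc (N : ℝ) * n ≤ 3 * (4 * x) ^ d * (d * x + 1) :=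
          mul_le_mul hN3 hn (Nat.cast_nonneg n) (by positivity)
      _ = 3 * (d * x * (4 * x) ^ d) + 3 * (4 * x) ^ d := by ring
      _ ≤ 12 * (d + 1) * X := by nlinarith
  have hX1 : 1 ≤ X := h1.trans h4X
  have hnX : (n : ℝ) ≤ 4 * (d + 1) * X := by nlinarith
  set D : ℝ := (d : ℝ) + 1 with hD
  have hD1 : 1 ≤ D := by linarith
  set Y : ℝ := K * D * X with hY
  have hKD : (K : ℝ) * D ≤ Y := le_mul_of_one_le_right (by positivity) hX1
  have hKDX : (K : ℝ) ≤ K * D := le_mul_of_one_le_right (by positivity) hD1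
  have hKX : (K : ℝ) * X ≤ Y := by
    rw [hY, mul_right_comm]
    exact le_mul_of_one_le_right (by positivity) hD1
  have hDX : D * X ≤ Y := by
    rw [hY, mul_assoc]
    exact le_mul_of_one_le_left (by positivity) hK'
  have hXY : X ≤ Y := (le_mul_of_one_le_left (by positivity) hK').trans hKX
  have hY1 : 1 ≤ Y := hX1.trans hXY
  have hYH : Y ≤ H * Y := le_mul_of_one_le_left (by positivity) hH'
  have e1 : (N : ℝ) * (K * D) ≤ 3 * Y := by
    calc (N : ℝ) * (K * D) ≤ 3 * X * (K * D) := mul_le_mul_of_nonneg_right hNX (by positivity)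
      _ = 3 * Y := by rw [hY]; ring
  have e2 : (N : ℝ) * n * K ≤ 12 * Y := by
    calc (N : ℝ) * n * K ≤ 12 * D * X * K := mul_le_mul_of_nonneg_right hNn (by positivity)
      _ = 12 * Y := by rw [hY]; ring
  have e3 : (N : ℝ) * K ≤ 3 * Y := (mul_le_mul_of_nonneg_left hKDX hN0).trans e1
  have e4 : (H : ℝ) * (N * (K * 105 + 40) + 90) ≤ H * (525 * Y) :=
    mul_le_mul_of_nonneg_left (by nlinarith) (by positivity)
  have e5 : (N : ℝ) * (K * (d * 300 + n * 50 + 410) + 60) ≤ 4000 * Y := by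
    have : (N : ℝ) * (K * (d * 300 + n * 50 + 410) + 60)
        = 300 * (N * (K * D)) + 50 * (N * n * K) + 110 * (N * K) + 60 * N := by rw [hD]; ring
    rw [this]
    linarith
  have hgoal : (H : ℝ) * K * (d + 1 : ℕ) * X = H * Y := by rw [hY, hD]; push_cast; ring
  rw [hgoal]
  push_cast
  linarith

end

theorem mainTheorem8 :
    ∃ (prog : RealRAM.Program) (C : ℝ),
      ∀ (nK nM : ℕ), 1 ≤ nK → 1 ≤ nM →
      ∀ (I : RecAPC (Fin nK) (Fin nM)), I.pMax < 1 →
      ∀ (H : ℕ), 1 ≤ H → ∀ (ε : ℝ), 0 < ε →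
      ∃ (T : ℕ) (out : RealRAM.Store),
        RealRAM.Runs prog (RealRAM.input I H ε) T out ∧
        out.IsAnswer nK H ∧
        (∀ π : RecAPC.Policy (Fin nK), out.Encodes H π →
          ∀ π' : RecAPC.Policy (Fin nK), I.value H π' - ε ≤ I.value H π) ∧
        (ε * (1 - I.pMax) ^ 2 ≤ 1 →
          (T : ℝ) ≤ C * ((H : ℝ) * (nK : ℝ) * (nM : ℝ) *
            (1 / (ε * (1 - I.pMax) ^ 2)) ^ (2 * nM - 2))) := by
  refine ⟨RealRAM.mainProg, 10000, ?_⟩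
  intro nK nM hK hM I hp H hH ε hε
  obtain ⟨d, rfl⟩ : ∃ d, nM = d + 1 := ⟨nM - 1, by omega⟩
  rw [show 2 * (d + 1) - 2 = 2 * d by omega]
  have h1p : 0 < 1 - I.pMax := by linarith
  have hp0 := RealRAM.pMax_nonneg I
  set x : ℝ := 1 / (ε * (1 - I.pMax) ^ 2) with hx
  by_cases hcase : ε * (1 - I.pMax) < I.pMax
  · have hx4 : 4 ≤ x := by
      rw [hx, le_div_iff₀ (by positivity)]
      nlinarith [sq_nonneg (2 * I.pMax - 1), mul_lt_mul_of_pos_right hcase h1p]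
    have hnx : 0 ≤ (d : ℝ) * x + 1 := by positivity
    have hNx : 0 ≤ 1 + 2 * (4 * x) ^ d := by positivity
    set n := ⌊(d : ℝ) * x + 1⌋₊ with hn
    set N := ⌊1 + 2 * (4 * x) ^ d⌋₊ with hN
    have hends := RealRAM.mainProg_ends (I := I) (H := H) (ε := ε)
      (T := 20 + (N * (nK * (d * 300 + n * 50 + 410) + 60) +
        H * (N * (nK * 105 + 40) + 90) + n * 32 + 200)) hK
      (Q := fun s' => (∀ t < H, s'.nat 1 t < nK) ∧ ∀ π π' : ℕ → ℕ, (∀ t, π t < nK) →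
        (∀ t, π' t < nK) → (∀ t < H, π t = s'.nat 1 t) →
        ApproxDP.linValue (d + 1) (fun k m => (RealRAM.input I H ε).real 0 (k * (d + 1) + m)) H π'
          ((RealRAM.input I H ε).real 1) ≤
        ApproxDP.linValue (d + 1) (fun k m => (RealRAM.input I H ε).real 0 (k * (d + 1) + m)) H π
          ((RealRAM.input I H ε).real 1) + ε) ?_
    · obtain ⟨T, out, hrun, hT, hans, hval⟩ := hends
      refine ⟨T, out, hrun, hans, fun π hπ π' => ?_, fun _ => ?_⟩
      · rw [RealRAM.value_eq_linValue I H ε, RealRAM.value_eq_linValue I H ε]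
        have := hval (fun t => π t) (fun t => π' t) (fun t => (π t).2) (fun t => (π' t).2) hπ
        linarith
      · refine le_trans (Nat.cast_le.2 hT) ?_
        exact steps_bound hH hK hx4 (Nat.floor_le hnx) (Nat.floor_le hNx)
    · intro s hnat hreal hs3
      have hs0 := hnat 0 (by omega)
      refine (RealRAM.Ends.cond (fun _ => RealRAM.solveProg_spec (s := s) (x := x) (n := n) (N := N)
        (by rw [hs0]; rfl) (by rw [hs0]; rfl) (by rw [hs0]; rfl) hH hK
        (by rw [hreal 2 (by norm_num)]; rfl) hs3 hp0 hp hε hx hx4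
        (Nat.lt_floor_add_one _) (Nat.lt_floor_add_one _)
        (fun k m => by rw [hreal 0 (by norm_num)]) (fun k hk m hm => ?_) (fun k hk m hm => ?_)
        (hreal 1 (by norm_num)) (fun m hm => ?_) ?_ (fun a ha => ?_) ?_) fun hb => ?_).mono ?_
        fun _ h => h
      · rw [RealRAM.input_pref I H ε ⟨k, hk⟩ ⟨m, hm⟩]
        exact (I.pref _ _).2.1
      · rw [RealRAM.input_pref I H ε ⟨k, hk⟩ ⟨m, hm⟩]
        exact RealRAM.pref_le_pMax I _ _
      · rw [RealRAM.input_prior I H ε ⟨m, hm⟩]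
        exact I.prior.2.1 _
      · rw [Finset.sum_range]
        simp only [RealRAM.input_prior]
        exact I.prior.2.2.le
      · rw [hnat a (Or.inl ha)]
        funext i
        simp [RealRAM.input, show a ≠ 0 by omega]
      · rw [hreal 6 (by norm_num)]
        funext i
        simp [RealRAM.input]
      · refine absurd ?_ hb
        simp only [RealRAM.Test.Holds, RealRAM.RealExpr.eval, RealRAM.NatExpr.eval, hs3,
          hreal 2 (by norm_num)]
        simpa [RealRAM.input] using hcase
      · exact Nat.add_le_add_right (by simp [RealRAM.Test.cost, RealRAM.RealExpr.cost,
          RealRAM.NatExpr.cost]) _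
  · have hends := RealRAM.mainProg_ends (I := I) (H := H) (ε := ε)
      (T := 20) hK (Q := fun s' => s'.nat 1 = fun _ => 0) ?_
    · obtain ⟨T, out, hrun, hT, hout⟩ := hends
      -- The untouched output array recommends category 0 throughout, which exists since |K| ≥ 1.
      refine ⟨T, out, hrun, fun t _ => by rw [hout]; exact hK, fun π _ π' => ?_, fun hle => ?_⟩
      · have h1 := RealRAM.value_nonneg (I := I) (H := H) π
        have h2 := RealRAM.value_le (H := H) hp π'
        have h3 : I.pMax / (1 - I.pMax) ≤ ε := (div_le_iff₀ h1p).2 (not_lt.1 hcase)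
        linarith
      · have hx1 : 1 ≤ x := (one_le_div (by positivity)).2 hle
        have hX : 1 ≤ x ^ (2 * d) := one_le_pow₀ hx1
        have hKH : (nK : ℝ) ≤ H * nK :=
          le_mul_of_one_le_left (by positivity) (by exact_mod_cast hH)
        have hKM : (nK : ℝ) * (d + 1 : ℕ) ≤ H * nK * (d + 1 : ℕ) :=
          mul_le_mul_of_nonneg_right hKH (by positivity)
        have hK1 : (1 : ℝ) ≤ nK := by exact_mod_cast hK
        have hK2 : (nK : ℝ) ≤ nK * (d + 1 : ℕ) :=
          le_mul_of_one_le_right (by positivity) (by exact_mod_cast hM)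
        have hQ : (H : ℝ) * nK * (d + 1 : ℕ) ≤ H * nK * (d + 1 : ℕ) * x ^ (2 * d) :=
          le_mul_of_one_le_right (by positivity) hX
        refine le_trans (Nat.cast_le.2 hT) ?_
        push_cast at hKM hK2 hQ ⊢
        linarith
    · intro s hnat hreal hs3
      refine (RealRAM.Ends.cond (T := 1) (fun hb => absurd hb ?_) fun _ =>
        RealRAM.Ends.skip ?_ le_rfl).mono ?_ fun _ h => h
      · simp only [RealRAM.Test.Holds, RealRAM.RealExpr.eval, RealRAM.NatExpr.eval, hs3,
          hreal 2 (by norm_num)]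
        simpa [RealRAM.input] using hcase
      · rw [hnat 1 (by omega)]
        funext i
        simp [RealRAM.input]
      · simp [RealRAM.Test.cost, RealRAM.RealExpr.cost, RealRAM.NatExpr.cost]
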